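/- **Theorem 4.3 (modern form of Abel's formula (37)).** Let $\mathbb K\subseteq\mathbb C$ be a subfield with algebraic closure $\overline{\mathbb K}$, let $\chi(x,y)\in\mathbb K[x,y]$ be monic of degree $n$ in $y$ and irreducible in $\mathbb C[x,y]$, and let $\theta(x,y,\underline a)\in\mathbb K[x,y,\underline a]$, $\underline a=(a_1,\dots,a_m)$ independent indeterminates, be a polynomial whose coefficients with respect to $x,y$ have degree $\le 1$ in $\underline a$. Let $r(x,\underline a)=\mathrm{Res}_y(\chi,\theta)=F_0(x)F(x,\underline a)$, where $0\neq F_0\in\mathbb K[x]$ and $F\in\mathbb K[x,\underline a]$ has no root $x$ algebraic over $\mathbb K$, and assume that $F$ is squarefree, i.e. $F$ and $F'=\partial F/\partial x$ have no common factor in $\mathbb K(\underline a)[x]$. Let $f(x,y)$ be a rational function over $\mathbb K$ whose denominator is not divisible by $\chi$, written on the curve $\chi=0$ as $f=f_1(x,y)/(f_2(x)\,\partial\chi/\partial y)$ with $f_1\in\mathbb K[x,y]$, $0\ne f_2\in\mathbb K[x]$. Let $\beta_1,\dots,\beta_\alpha\in\overline{\mathbb K}$ be the distinct roots of $f_2F_0$.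 *Expansions.* At each $\beta\in\{\beta_1,\dots,\beta_\alpha,\infty\}$ put $T=x-\beta$ (resp. $T=1/x$ if $\beta=\infty$). Then $\chi(x,y)$ has $n$ roots $y^{(1)},\dots,y^{(n)}$ that are Puiseux series in $T$ over $\overline{\mathbb K}$, and $\theta(y^{(\ell)})=\theta(x,y^{(\ell)},\underline a)=c_{\beta,\ell}\,T^{e}(1+W)$ with $e\in\mathbb Q$, $W$ having only positive exponents, and $0\ne c_{\beta,\ell}\in\overline{\mathbb K}[\underline a]_{\le1}=\{\lambda_0+\sum_i\lambda_ia_i:\lambda_i\in\overline{\mathbb K}\}$. *Differential field.* There is an algebraically closed differential field extension of $(\mathbb K(\underline a);\partial/\partial a_1,\dots,\partial/\partial a_m)$, with commuting derivations $\partial_1,\dots,\partial_m$, that contains a logarithm of every nonzero $c\in\overline{\mathbb K}[\underline a]_{\le 1}$, i.e. an element $\log c$ with $\partial_i\log c=\partial_i c/c$ for all $i$. Let $M$ be any algebraically closed differential extension of this kind that contains logarithms of the finitely many elements $c_{\beta,\ell}$, and write $\delta g=\sum_i\partial_i g\,da_i$ for $g\in M$. Define $$\log_\beta\theta(y^{(\ell)})=\log(c_{\beta,\ell})+\sum_{k\ge1}\frac{(-1)^{k-1}W^k}{k},\qquad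 \widehat S_\beta=\sum_{\ell=1}^n f(x,y^{(\ell)})\,\log_\beta\theta(y^{(\ell)}).$$ The constant term of $\log_\beta\theta(y^{(\ell)})$ is $\log (c_{\beta,\ell})$ and its other coefficients lie in $\overline{\mathbb K}(\underline a)$. Let $\mathrm{res}_{\beta}$ be the coefficient of $1/(x-\beta)$ for finite $\beta$, and $\varPi$ the coefficient of $1/x$ in an expansion at $\infty$. *Formula.* The set of solutions $(x_1,y_1),\dots,(x_\mu,y_\mu)\in M^2$ of $\chi(x,y)=\theta(x,y,\underline a)=0$ with $x_i$ transcendental over $\mathbb K$ is finite, and with $dv=\sum_{i=1}^\mu f(x_i,y_i)\,dx_i$, where $dx_i=\delta x_i$, $$dv=\delta\Big(\sum_{j=1}^\alpha\mathrm{res}_{\beta_j}(\widehat S_{\beta_j})-\varPi(\widehat S_\infty)\Big).$$ Consequently $v=\sum_{i=1}^\mu\int f(x_i,y_i)\,dx_i$ is given by $$v=\sum_{j=1}^\alpha\mathrm{res}_{\beta_j}\Big(\sum_{\ell=1}^n f(x,y^{(\ell)})\log_{\beta_j}\theta(y^{(\ell)})\Big)-\varPi\Big(\sum_{\ell=1}^n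 f(x,y^{(\ell)})\log_\infty\theta(y^{(\ell)})\Big)+C$$ with $C$ a constant ($\delta C=0$): the elements $v\in M$ with $\delta v=dv$ are exactly those of this form, and whenever $I_i\in M$ satisfies $\delta I_i=f(x_i,y_i)\,dx_i$ for $i=1,\dots,\mu$, the sum $v=\sum_i I_i$ is of this form. -/

import Mathlib

open Polynomial

namespace AbelFormula

noncomputable section

/-! ### Algebraic data over the base field -/

section Base

variable {K : Type*} [Field K] {m : ℕ}

/-- The resultant `r(x) = Res_y(χ(x,y), θ(x,y,a))` in `K[a][x]`. In `K[x][y]` the outer variable is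
`y` and the inner one is `x`. -/
def resultantInX (χ : K[X][X]) (θ : (MvPolynomial (Fin m) K)[X][X]) :
    (MvPolynomial (Fin m) K)[X] :=
  resultant (χ.map (mapRingHom (MvPolynomial.C : K →+* MvPolynomial (Fin m) K))) θ

/-- `F ∈ K[a][x]` has no root `x = z` that is algebraic over `K`. -/
def HasNoAlgebraicRoot (F : (MvPolynomial (Fin m) K)[X]) : Prop :=
  ∀ z : AlgebraicClosure K,
    F.eval₂ (MvPolynomial.map (algebraMap K (AlgebraicClosure K))) (MvPolynomial.C z) ≠ 0

/-- The factorization `r(x,a) = F₀(x) F(x,a)` in which `F₀` collects the roots that are algebraic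
over `K`, and no root of `F` is algebraic over `K`. -/
structure IsResultantFactorization (χ : K[X][X]) (θ : (MvPolynomial (Fin m) K)[X][X])
    (F₀ : K[X]) (F : (MvPolynomial (Fin m) K)[X]) : Prop where
  ne_zero : F₀ ≠ 0
  eq_mul : resultantInX χ θ = F₀.map MvPolynomial.C * F
  no_algebraic_root : HasNoAlgebraicRoot F

/-- `F(x)` and `F'(x) = ∂F/∂x` have no common factor in `K(a)[x]`. -/
def IsSquarefreeInX (F : (MvPolynomial (Fin m) K)[X]) : Prop :=
  (F.map (algebraMap (MvPolynomial (Fin m) K)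
    (FractionRing (MvPolynomial (Fin m) K)))).Separable

/-- On the curve `χ = 0` the rational function `p / q` equals `f₁(x,y) / (f₂(x) χ'(y))`, where
`χ' = ∂χ/∂y`. -/
structure IsRepresentation (χ p q f₁ : K[X][X]) (f₂ : K[X]) : Prop where
  ne_zero : f₂ ≠ 0
  dvd : χ ∣ f₁ * q - C f₂ * derivative χ * p

end Base

/-! ### Differential fields -/

section Differential

variable (K : Type*) {M : Type*} [Field K] [Field M] [Algebra K M] {m : ℕ}

/-- `M`, with the derivations `D₁, …, D_m`, is a differential field extension of
`(K(a₁,…,a_m); ∂/∂a₁, …, ∂/∂a_m)`: the `a_i ∈ M` are algebraically independent over `K`, the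
`D_i` commute, are `K`-linear, and restrict to `∂/∂a_i` on `K(a)`. -/
structure IsDifferentialExtension (a : Fin m → M) (D : Fin m → Derivation K M M) : Prop where
  algebraicIndependent : AlgebraicIndependent K a
  apply_indeterminate : ∀ i j, D i (a j) = if i = j then 1 else 0
  comm : ∀ i j z, D i (D j z) = D j (D i z)

variable {K}

/-- `v` is an antiderivative of the differential form `∑ i, ω i da_i`, that is `δ v = ω`. -/
def IsAntiderivative (D : Fin m → Derivation K M M) (v : M) (ω : Fin m → M) : Prop :=
  ∀ i, D i v = ω i

/-- `C` is a constant: `δ C = 0`. -/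
def IsConstant (D : Fin m → Derivation K M M) (C : M) : Prop :=
  ∀ i, D i C = 0

/-- For each `c ∈ S`, the element `L c` is a logarithm of `c`: `δ (L c) = δ c / c`. -/
def IsLogOn (D : Fin m → Derivation K M M) (L : M → M) (S : Set M) : Prop :=
  ∀ c ∈ S, IsAntiderivative D (L c) (fun i => D i c / c)

variable (K)

/-- `K̄[a]_{≤ 1}`: the elements `c₀ + ∑ i, c_i a_i` with all `c_i` algebraic over `K`. -/
def affineForms (a : Fin m → M) : Set M :=
  {z | ∃ (c₀ : M) (c : Fin m → M), IsAlgebraic K c₀ ∧ (∀ i, IsAlgebraic K (c i)) ∧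
    z = c₀ + ∑ i, c i * a i}

/-- The field `K̄(a)` inside `M`. -/
def rationalFunctionField (a : Fin m → M) : IntermediateField K M :=
  IntermediateField.adjoin K ({z : M | IsAlgebraic K z} ∪ Set.range a)

/-- `θ(x,y,a)`, with the given elements of `M` substituted for the indeterminates `a`, as a
polynomial in `x` and `y` over `M`. -/
def specialize (a : Fin m → M) (θ : (MvPolynomial (Fin m) K)[X][X]) : M[X][X] :=
  θ.map (mapRingHom (MvPolynomial.aeval a : MvPolynomial (Fin m) K →ₐ[K] M).toRingHom)

/-- The value of the rational function `p(x,y) / q(x,y)` at a point `(x, y)` with coordinates in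
a field extension of `K`. -/
def evalQuotient {N : Type*} [Field N] [Algebra K N] (p q : K[X][X]) (x y : N) : N :=
  aevalAeval x y p / aevalAeval x y q

/-- The solutions `(x, y)` in `M` of `χ(x,y) = θ(x,y,a) = 0` with `x` transcendental over `K`. -/
def solutions (a : Fin m → M) (χ : K[X][X]) (θ : (MvPolynomial (Fin m) K)[X][X]) :
    Set (M × M) :=
  {s | aevalAeval s.1 s.2 χ = 0 ∧ aevalAeval s.1 s.2 (specialize K a θ) = 0 ∧
    Transcendental K s.1}

/-- The differential form `dv = ∑ f(x_i,y_i) dx_i`, the sum running over `solutions`, where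
`f = p / q`; its `k`-th component is the coefficient of `da_k`. -/
def dv (a : Fin m → M) (D : Fin m → Derivation K M M) (χ : K[X][X])
    (θ : (MvPolynomial (Fin m) K)[X][X]) (p q : K[X][X]) (k : Fin m) : M :=
  ∑ᶠ s ∈ solutions K a χ θ, evalQuotient K p q s.1 s.2 * D k s.1

end Differential

/-! ### Puiseux expansions

Series with rational exponents are elements of `HahnSeries ℚ M`. The variable `T = single 1 1`
stands for `x - β` at a finite point `β` and for `1 / x` at infinity. -/

section Puiseux

variable (K : Type*) {M : Type*} [Field K] [Field M] [Algebra K M] {m : ℕ}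

/-- The coordinate `x = β + T`, where `T = x - β`. -/
def xAt (β : M) : HahnSeries ℚ M :=
  HahnSeries.C β + HahnSeries.single 1 1

/-- The coordinate `x = T⁻¹`, where `T = 1 / x`. -/
def xAtInfinity : HahnSeries ℚ M :=
  HahnSeries.single (-1) 1

/-- `s` is a Puiseux series (exponents with a common denominator) with coefficients in `K̄`. -/
def IsPuiseux (s : HahnSeries ℚ M) : Prop :=
  (∃ h : ℕ, 0 < h ∧ ∀ e ∈ s.support, ∃ j : ℤ, e = (j : ℚ) / (h : ℚ)) ∧
    ∀ e, IsAlgebraic K (s.coeff e)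

/-- The expansions of the roots `y⁽¹⁾, …, y⁽ⁿ⁾` of `χ(x, y)`, where `x` is the given coordinate
series. -/
def localRoots (χ : K[X][X]) (x : HahnSeries ℚ M) : Multiset (HahnSeries ℚ M) :=
  (χ.map (aeval x : K[X] →ₐ[K] HahnSeries ℚ M).toRingHom).roots

/-- The expansion of `θ(x, y, a)`. -/
def localTheta (a : Fin m → M) (θ : (MvPolynomial (Fin m) K)[X][X])
    (x y : HahnSeries ℚ M) : HahnSeries ℚ M :=
  aevalAeval x y (specialize K a θ)

/-- If `s = c T ^ e (1 + W)` with `c ≠ 0` and `W` of positive order, then the modified logarithm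
of `s` is the series `L c + ∑_{k ≥ 1} (-1)^(k-1) W^k / k`, where `L` is the logarithm on
coefficients. (The coefficient for `k = 0` of the power series below is `-1 / 0 = 0`.) -/
def localLog (L : M → M) (s : HahnSeries ℚ M) : HahnSeries ℚ M :=
  HahnSeries.C (L s.leadingCoeff) +
    PowerSeries.heval (s / HahnSeries.single s.order s.leadingCoeff - 1)
      (PowerSeries.mk fun k : ℕ => (-1 : M) ^ (k + 1) / (k : M))

/-- `Ŝ = ∑_ℓ f(x,y⁽ˡ⁾) log θ(y⁽ˡ⁾)` at the point with coordinate series `x`, where `f = p / q` and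
`log` is `localLog L`. -/
def Shat (a : Fin m → M) (L : M → M) (χ : K[X][X]) (θ : (MvPolynomial (Fin m) K)[X][X])
    (p q : K[X][X]) (x : HahnSeries ℚ M) : HahnSeries ℚ M :=
  ((localRoots K χ x).map fun y =>
    evalQuotient K p q x y * localLog L (localTheta K a θ x y)).sum

/-- `res_β`: the coefficient of `1 / (x - β) = T⁻¹`. -/
def res (s : HahnSeries ℚ M) : M := s.coeff (-1)

/-- `Π`: the coefficient of `1 / x = T` in an expansion at infinity. -/
def coeffInvX (s : HahnSeries ℚ M) : M := s.coeff 1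

open Classical in
/-- The distinct roots in `M` of a polynomial over `K`. -/
def rootsIn (M : Type*) [Field M] [Algebra K M] (g : K[X]) : Finset M :=
  (g.aroots M).toFinset

/-- The coordinate series at the roots of `g` and at infinity. -/
def expansionPoints (M : Type*) [Field M] [Algebra K M] (g : K[X]) : Set (HahnSeries ℚ M) :=
  {x | (∃ β ∈ rootsIn K M g, x = xAt β) ∨ x = xAtInfinity}

/-- The leading coefficients `c_{β,ℓ}`, `c_{∞,ℓ}` of the expansions of `θ(y⁽ˡ⁾)` at the roots
`β` of `g` and at infinity; only logarithms of these elements are used. -/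
def logArguments (a : Fin m → M) (χ : K[X][X]) (θ : (MvPolynomial (Fin m) K)[X][X])
    (g : K[X]) : Set M :=
  {c | ∃ x ∈ expansionPoints K M g, ∃ y ∈ localRoots K χ x,
    c = (localTheta K a θ x y).leadingCoeff}

/-- `∑_β res_β(Ŝ_β) - Π(Ŝ_∞)`, where `β` runs over the roots of `g`. -/
def abelSum (a : Fin m → M) (L : M → M) (χ : K[X][X]) (θ : (MvPolynomial (Fin m) K)[X][X])
    (p q : K[X][X]) (g : K[X]) : M :=
  ∑ β ∈ rootsIn K M g, res (Shat K a L χ θ p q (xAt β)) -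
    coeffInvX (Shat K a L χ θ p q xAtInfinity)

end Puiseux

end

end AbelFormula

/-!
Abel's formula is the residue theorem on the projective line, applied to the derivative of `Ŝ`.

Let `D` be one of the derivations `∂_k` of `M`, extended to series by acting on coefficients
(`coeffDerivation`). The roots `y` of `χ(x, y)` are Puiseux series with algebraic coefficients
(`splits_of_monic_puiseuxSubring`), so `D` kills `x`, `y` and `f(x, y)`, while the modified logarithm
has the expected logarithmic derivative (`coeffDerivation_localLog`). Hence
`D Ŝ = ∑ f(x, y) (Dθ)(x, y) / θ(x, y)`, where `Dθ` is the derivative of the coefficients of `θ`. Since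
`Aθ + Bχ = r` with polynomials `A` and `B`, the factor `1 / θ` is `A / r` on the curve, and Euler's
formula for `∑ G(y) / χ'(y)` (`sum_roots_eval_div_derivative`) turns the sum into one rational
function `N(x) / (f₂(x) r(x))`, the same at all expansion points (`coeffDerivation_Shat`).

By the residue theorem (`sum_res_div_eq_coeffInvX_div`) the residues of this function at the roots of
`f₂F₀`, minus the coefficient at infinity, add up to minus the residues at the remaining poles. These
are the roots `x_i` of `F`; they are transcendental over `K` and simple. At `x_i` the numerator is
again a sum over the points of the curve: `A` vanishes at those with `θ ≠ 0`, and where `θ = 0`,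
differentiating the coefficients of `Aθ + Bχ = r` gives `A Dθ = -r'(x_i) D x_i`
(`aevalAeval_mul_derivCoeffs`). So the residue is `-∑ f(x_i, y) D x_i`, the sum running over the
solutions with first coordinate `x_i` (`res_traceNumerator_div`), and altogether `D` of the sum of
residues is `dv`.

Puiseux's theorem is proved by Newton's method: after a translation and a rescaling along the least
slope of the Newton polygon, the Weierstrass preparation theorem yields a proper factor. The
differential field `M` with all logarithms is the algebraic closure of a rational function field with
an additional indeterminate for each logarithm; derivations extend uniquely along formally étale
algebras.
-/

namespace AbelFormula

noncomputable section

/-! ### Residues of rational functions -/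

section Residues

variable {M : Type*} [Field M]

lemma coeff_ofPowerSeries_of_neg (f : PowerSeries M) {e : ℚ} (he : e < 0) :
    (HahnSeries.ofPowerSeries ℚ M f).coeff e = 0 := by
  rw [HahnSeries.ofPowerSeries_apply]
  refine HahnSeries.embDomain_of_notMem_range ?_
  rintro ⟨n, hn⟩
  simp at hn
  have : (0 : ℚ) ≤ n := n.cast_nonneg
  linarith

/-- The structure map of Hahn series over an extension of the base field is the embedding of the
constants. The instance found for the algebra structure passes through power series, so that this
is not definitional. -/
lemma algebraMap_hahnSeries {K : Type*} [Field K] [Algebra K M] (c : K) :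
    algebraMap K (HahnSeries ℚ M) c = HahnSeries.C (algebraMap K M c) := by
  have h : algebraMap K (PowerSeries M) c = PowerSeries.C (algebraMap K M c) :=
    PowerSeries.algebraMap_apply
  rw [HahnSeries.algebraMap_apply', h, HahnSeries.ofPowerSeries_C]

lemma aeval_xAt (β : M) (P : M[X]) : aeval (xAt β) P =
    HahnSeries.ofPowerSeries ℚ M ((taylor β P : M[X]) : PowerSeries M) := by
  induction P using Polynomial.induction_on' with
  | add p q hp hq => simp [hp, hq]
  | monomial n a =>
    rw [aeval_monomial, taylor_monomial]
    simp [algebraMap_hahnSeries, xAt, add_comm]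

lemma aeval_xAt_ne_zero (β : M) {P : M[X]} (hP : P ≠ 0) : aeval (xAt β) P ≠ 0 := by
  rw [aeval_xAt]
  simpa [map_eq_zero_iff _ (HahnSeries.ofPowerSeries_injective (Γ := ℚ) (R := M))] using hP

/-- At a point that is no pole, a rational function expands into a power series in `x - β`. -/
lemma aeval_xAt_div_aeval_xAt (β : M) (P : M[X]) {Q : M[X]} (hQ : Q.eval β ≠ 0) :
    aeval (xAt β) P / aeval (xAt β) Q =
      HahnSeries.ofPowerSeries ℚ M
        (((taylor β P : M[X]) : PowerSeries M) * ((taylor β Q : M[X]) : PowerSeries M)⁻¹) := by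
  have h0 : Q ≠ 0 := by rintro rfl; simp at hQ
  have hc : PowerSeries.constantCoeff ((taylor β Q : M[X]) : PowerSeries M) ≠ 0 := by
    rwa [Polynomial.constantCoeff_coe, taylor_coeff_zero]
  rw [div_eq_iff (aeval_xAt_ne_zero β h0), aeval_xAt, aeval_xAt, ← map_mul, mul_assoc,
    PowerSeries.inv_mul_cancel _ hc, mul_one]

lemma res_div_of_eval_ne_zero (β : M) (P : M[X]) {Q : M[X]} (hQ : Q.eval β ≠ 0) :
    res (aeval (xAt β) P / aeval (xAt β) Q) = 0 := by
  rw [aeval_xAt_div_aeval_xAt β P hQ]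
  exact coeff_ofPowerSeries_of_neg _ (by norm_num)

/-- The residue at a simple pole. -/
lemma res_div_X_sub_C_mul (β : M) (P : M[X]) {Q : M[X]} (hQ : Q.eval β ≠ 0) :
    res (aeval (xAt β) P / aeval (xAt β) ((X - C β) * Q)) = P.eval β / Q.eval β := by
  have h1 : aeval (xAt β) (X - C β) = HahnSeries.single (1 : ℚ) (1 : M) := by
    simp [xAt, algebraMap_hahnSeries]
  rw [map_mul, h1, mul_comm, ← div_div, aeval_xAt_div_aeval_xAt β P hQ, div_eq_mul_inv,
    HahnSeries.inv_single, res]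
  have h2 := HahnSeries.coeff_mul_single_add (r := (1 : M)⁻¹) (a := (0 : ℚ)) (b := -1)
    (x := HahnSeries.ofPowerSeries ℚ M
        (((taylor β P : M[X]) : PowerSeries M) * ((taylor β Q : M[X]) : PowerSeries M)⁻¹))
  rw [zero_add] at h2
  rw [h2]
  have h3 := HahnSeries.ofPowerSeries_apply_coeff (Γ := ℚ)
    (((taylor β P : M[X]) : PowerSeries M) * ((taylor β Q : M[X]) : PowerSeries M)⁻¹) 0
  rw [Nat.cast_zero] at h3
  rw [h3]
  simp [taylor_coeff_zero, div_eq_mul_inv]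

lemma coeff_aeval_xAtInfinity_neg (P : M[X]) (n : ℕ) :
    (aeval (xAtInfinity : HahnSeries ℚ M) P).coeff (-(n : ℚ)) = P.coeff n := by
  induction P using Polynomial.induction_on' with
  | add p q hp hq => simp [hp, hq]
  | monomial k a =>
    rw [aeval_monomial, xAtInfinity, HahnSeries.single_pow, algebraMap_hahnSeries,
      HahnSeries.C_mul_eq_smul, HahnSeries.coeff_smul, coeff_monomial, HahnSeries.coeff_single]
    by_cases h : k = n
    · simp [h]
    · have : ¬ ((n : ℚ) = k) := fun h' => h (by exact_mod_cast h'.symm)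
      simp [h, this]

lemma coeffInvX_aeval (P : M[X]) :
    coeffInvX (aeval (xAtInfinity : HahnSeries ℚ M) P) = 0 := by
  rw [coeffInvX]
  induction P using Polynomial.induction_on' with
  | add p q hp hq => simp [hp, hq]
  | monomial k a =>
    rw [aeval_monomial, xAtInfinity, HahnSeries.single_pow, algebraMap_hahnSeries,
      HahnSeries.C_mul_eq_smul, HahnSeries.coeff_smul, HahnSeries.coeff_single]
    have : ¬ ((1 : ℚ) = -k) := by
      have : (0 : ℚ) ≤ k := k.cast_nonneg
      intro h; linarith
    simp [this]

lemma aeval_xAtInfinity_ne_zero {P : M[X]} (hP : P ≠ 0) :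
    aeval (xAtInfinity : HahnSeries ℚ M) P ≠ 0 := by
  intro h
  refine hP (Polynomial.ext fun n => ?_)
  rw [← coeff_aeval_xAtInfinity_neg, h]
  simp

lemma coeffInvX_inv_X_sub_C_pow (γ : M) (j : ℕ) :
    coeffInvX (((aeval (xAtInfinity : HahnSeries ℚ M) (X - C γ)) ^ (j + 1))⁻¹) =
      if j = 0 then 1 else 0 := by
  set u : PowerSeries M := 1 - PowerSeries.C γ * PowerSeries.X with hu
  have hu0 : PowerSeries.constantCoeff u ≠ 0 := by simp [hu]
  have h1 : aeval (xAtInfinity : HahnSeries ℚ M) (X - C γ) *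
      HahnSeries.ofPowerSeries ℚ M PowerSeries.X = HahnSeries.ofPowerSeries ℚ M u := by
    simp [xAtInfinity, hu, sub_mul, algebraMap_hahnSeries, HahnSeries.single_mul_single]
  have h2 : (aeval (xAtInfinity : HahnSeries ℚ M) (X - C γ))⁻¹ =
      HahnSeries.ofPowerSeries ℚ M (PowerSeries.X * u⁻¹) := by
    rw [inv_eq_iff_eq_inv, eq_comm, inv_eq_of_mul_eq_one_left]
    rw [map_mul, ← mul_assoc, h1, ← map_mul, PowerSeries.mul_inv_cancel _ hu0, map_one]
  have h3 := HahnSeries.ofPowerSeries_apply_coeff (Γ := ℚ) ((PowerSeries.X * u⁻¹) ^ (j + 1)) 1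
  rw [Nat.cast_one] at h3
  rw [← inv_pow, h2, ← map_pow, coeffInvX, h3]
  rw [mul_pow]
  rcases j with _ | j
  · rw [zero_add, pow_one, pow_one, show (1 : ℕ) = 0 + 1 from rfl, PowerSeries.coeff_succ_X_mul]
    simp [hu]
  · rw [PowerSeries.coeff_of_lt_order]
    · simp
    · refine lt_of_lt_of_le ?_ (PowerSeries.le_order_mul _ _)
      refine lt_of_lt_of_le ?_ le_self_add
      rw [PowerSeries.order_X_pow]
      exact_mod_cast (by omega : 1 < j + 1 + 1)

open Classical in
lemma res_inv_X_sub_C_pow (β γ : M) (j : ℕ) :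
    res (((aeval (xAt β) (X - C γ)) ^ (j + 1))⁻¹) = if β = γ ∧ j = 0 then 1 else 0 := by
  by_cases h : β = γ
  · subst h
    have h1 : aeval (xAt β) (X - C β) = HahnSeries.single (1 : ℚ) (1 : M) := by
      simp [xAt, algebraMap_hahnSeries]
    rw [h1, HahnSeries.single_pow, HahnSeries.inv_single, res, HahnSeries.coeff_single]
    by_cases hj : j = 0
    · simp [hj]
    · have : ¬ (-1 : ℚ) = -1 + -(j : ℚ) := by
        intro h
        have : (j : ℚ) = 0 := by linarith
        exact hj (by exact_mod_cast this)
      simp [hj, this]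
  · have := res_div_of_eval_ne_zero β 1 (Q := (X - C γ) ^ (j + 1))
      (by simpa [sub_eq_zero] using h)
    rw [map_one, map_pow, one_div] at this
    rw [this, if_neg (fun h' => h h'.1)]

lemma res_aeval (β : M) (P : M[X]) : res (aeval (xAt β) P) = 0 := by
  simpa using res_div_of_eval_ne_zero β P (Q := 1) (by simp)

lemma res_add (s t : HahnSeries ℚ M) : res (s + t) = res s + res t := rfl

lemma coeffInvX_add (s t : HahnSeries ℚ M) : coeffInvX (s + t) = coeffInvX s + coeffInvX t := rfl

lemma res_sum {ι : Type*} (S : Finset ι) (s : ι → HahnSeries ℚ M) :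
    res (∑ i ∈ S, s i) = ∑ i ∈ S, res (s i) := by
  simp [res]

lemma coeffInvX_sum {ι : Type*} (S : Finset ι) (s : ι → HahnSeries ℚ M) :
    coeffInvX (∑ i ∈ S, s i) = ∑ i ∈ S, coeffInvX (s i) := by
  simp [coeffInvX]

lemma res_C_mul (c : M) (s : HahnSeries ℚ M) : res (HahnSeries.C c * s) = c * res s := by
  simp [res]

lemma coeffInvX_C_mul (c : M) (s : HahnSeries ℚ M) :
    coeffInvX (HahnSeries.C c * s) = c * coeffInvX s := by
  simp [coeffInvX]

/-- The partial fraction decomposition of a rational function whose denominator splits, evaluated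
at a transcendental element of a field extension. -/
lemma exists_partial_fractions [IsAlgClosed M] (P : M[X]) {Q : M[X]} (hQ : Q ≠ 0) :
    ∃ (n : M → ℕ) (q : M[X]) (r : (γ : M) → Fin (n γ) → M),
      ∀ (N : Type _) [Field N] [Algebra M N] (z : N), (∀ R : M[X], R ≠ 0 → aeval z R ≠ 0) →
        aeval z P / aeval z Q = aeval z q +
          ∑ γ ∈ Q.rootSet M |>.toFinset, ∑ j,
            algebraMap M N (r γ j) * ((aeval z (X - C γ)) ^ ((Fin.rev j).1 + 1))⁻¹ := by
  classical
  have hsplit := IsAlgClosed.splits Q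
  set S : Finset M := (Q.rootSet M).toFinset with hS
  have hS' : S = Q.roots.toFinset := by
    ext γ
    simp [hS, hQ, mem_rootSet]
  have hfac : Q = C Q.leadingCoeff * ∏ γ ∈ S, (X - C γ) ^ Q.roots.count γ := by
    conv_lhs => rw [hsplit.eq_prod_roots]
    rw [hS', Finset.prod_multiset_map_count]
  obtain ⟨q, r, hr, h⟩ := eq_quo_mul_prod_pow_add_sum_rem_mul_prod_pow (s := S)
    (C Q.leadingCoeff⁻¹ * P) (g := fun γ => X - C γ) (fun γ _ => monic_X_sub_C γ)
    (fun γ _ δ _ hne => (pairwise_coprime_X_sub_C Function.injective_id hne))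
    (fun γ => Q.roots.count γ)
  refine ⟨fun γ => Q.roots.count γ, q, fun γ j => (r γ j).coeff 0, fun N _ _ z hz => ?_⟩
  have hlc : algebraMap M N Q.leadingCoeff ≠ 0 := by simpa using hQ
  have hz' : ∀ γ, aeval z (X - C γ) ≠ 0 := fun γ => hz _ (X_sub_C_ne_zero γ)
  set D : N := ∏ γ ∈ S, (aeval z (X - C γ)) ^ Q.roots.count γ with hD
  have hD0 : D ≠ 0 := Finset.prod_ne_zero_iff.mpr fun γ _ => pow_ne_zero _ (hz' γ)
  have hQz : aeval z Q = algebraMap M N Q.leadingCoeff * D := by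
    conv_lhs => rw [hfac]
    simp [hD, map_prod]
  have hP := congrArg (aeval z) h
  rw [map_mul, aeval_C, map_inv₀] at hP
  have : aeval z P / aeval z Q = ((algebraMap M N Q.leadingCoeff)⁻¹ * aeval z P) / D := by
    rw [hQz]; field_simp
  rw [this, hP, div_eq_iff hD0, add_mul, Finset.sum_mul, map_add, map_mul, map_sum, map_prod]
  congr 1
  · simp [hD]
  refine Finset.sum_congr rfl fun γ hγ => ?_
  rw [Finset.sum_mul, map_sum]
  refine Finset.sum_congr rfl fun j _ => ?_
  have hdeg := hr γ hγ j
  rw [degree_X_sub_C] at hdeg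
  have hC : r γ j = C ((r γ j).coeff 0) :=
    eq_C_of_degree_le_zero (Nat.WithBot.lt_one_iff_le_zero.mp hdeg)
  conv_lhs => rw [hC]
  rw [hD, ← Finset.mul_prod_erase S _ hγ, map_mul, map_mul, aeval_C, map_prod]
  simp only [map_pow]
  have hj : aeval z (X - C γ) ^ Q.roots.count γ =
      aeval z (X - C γ) ^ ((Fin.rev j).1 + 1) * aeval z (X - C γ) ^ j.1 := by
    rw [← pow_add, Fin.val_rev]
    congr 1
    omega
  rw [mul_assoc, mul_assoc, hj, mul_assoc, inv_mul_cancel_left₀ (pow_ne_zero _ (hz' γ))]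

/-- The residue theorem for rational functions on the projective line. -/
theorem sum_res_div_eq_coeffInvX_div [IsAlgClosed M] (P : M[X]) {Q : M[X]} (hQ : Q ≠ 0)
    (S : Finset M) (hS : ∀ γ, Q.eval γ = 0 → γ ∈ S) :
    ∑ β ∈ S, res (aeval (xAt β) P / aeval (xAt β) Q) =
      coeffInvX (aeval xAtInfinity P / aeval xAtInfinity Q) := by
  classical
  obtain ⟨n, q, r, h⟩ := exists_partial_fractions P hQ
  rw [h (HahnSeries ℚ M) xAtInfinity fun R hR => aeval_xAtInfinity_ne_zero hR,
    coeffInvX_add, coeffInvX_aeval, zero_add, coeffInvX_sum]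
  have h1 : ∀ β : M, res (aeval (xAt β) P / aeval (xAt β) Q) =
      ∑ γ ∈ Q.rootSet M |>.toFinset, ∑ j, r γ j * if β = γ ∧ (Fin.rev j).1 = 0 then 1 else 0 := by
    intro β
    rw [h (HahnSeries ℚ M) (xAt β) fun R hR => aeval_xAt_ne_zero β hR, res_add, res_aeval,
      zero_add, res_sum]
    refine Finset.sum_congr rfl fun γ _ => ?_
    rw [res_sum]
    refine Finset.sum_congr rfl fun j _ => ?_
    rw [algebraMap_hahnSeries, res_C_mul, res_inv_X_sub_C_pow]
    rfl
  rw [Finset.sum_congr rfl fun β _ => h1 β, Finset.sum_comm]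
  refine Finset.sum_congr rfl fun γ hγ => ?_
  rw [coeffInvX_sum, Finset.sum_comm]
  refine Finset.sum_congr rfl fun j _ => ?_
  rw [algebraMap_hahnSeries, coeffInvX_C_mul, coeffInvX_inv_X_sub_C_pow, ← Finset.mul_sum]
  have hγS : γ ∈ S := hS γ (by simpa [mem_rootSet, hQ] using hγ)
  simp only [Algebra.algebraMap_self, RingHom.id_apply]
  congr 1
  generalize (Fin.rev j).1 = i
  by_cases hj : i = 0 <;> simp [hj, hγS]

end Residues

/-! ### Coefficientwise derivations and logarithmic derivatives -/

section LogDerivative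

variable {K M : Type*} [Field K] [Field M] [Algebra K M]

/-- The derivation of Hahn series that differentiates the coefficients and kills the variable, as
an additive map. -/
def coeffDerivation (D : Derivation K M M) : HahnSeries ℚ M →+ HahnSeries ℚ M where
  toFun s := HahnSeries.map s D
  map_zero' := by ext; simp
  map_add' s t := by ext; simp

lemma coeffDerivation_coeff (D : Derivation K M M) (s : HahnSeries ℚ M) (e : ℚ) :
    (coeffDerivation D s).coeff e = D (s.coeff e) := rfl

lemma coeffDerivation_mul (D : Derivation K M M) (x y : HahnSeries ℚ M) :
    coeffDerivation D (x * y) = x * coeffDerivation D y + y * coeffDerivation D x := by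
  have hx : (coeffDerivation D x).support ⊆ x.support := fun e he h => he (by
    rw [coeffDerivation_coeff, h, map_zero])
  have hy : (coeffDerivation D y).support ⊆ y.support := fun e he h => he (by
    rw [coeffDerivation_coeff, h, map_zero])
  ext e
  rw [coeffDerivation_coeff, HahnSeries.coeff_add, HahnSeries.coeff_mul, mul_comm y,
    HahnSeries.coeff_mul_right' y.isPWO_support hy,
    HahnSeries.coeff_mul_left' x.isPWO_support hx, ← Finset.sum_add_distrib, map_sum]
  refine Finset.sum_congr rfl fun ij _ => ?_
  simp [coeffDerivation_coeff, mul_comm]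

lemma coeffDerivation_single (D : Derivation K M M) (e : ℚ) (c : M) :
    coeffDerivation D (HahnSeries.single e c) = HahnSeries.single e (D c) := by
  ext e'
  rw [coeffDerivation_coeff, HahnSeries.coeff_single, HahnSeries.coeff_single]
  split_ifs <;> simp

lemma coeffDerivation_C (D : Derivation K M M) (c : M) :
    coeffDerivation D (HahnSeries.C c) = HahnSeries.C (D c) :=
  coeffDerivation_single D 0 c

lemma coeffDerivation_eq_zero {D : Derivation K M M} {s : HahnSeries ℚ M}
    (h : ∀ e, D (s.coeff e) = 0) : coeffDerivation D s = 0 := by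
  ext e
  rw [coeffDerivation_coeff, h, HahnSeries.coeff_zero]

lemma zero_le_orderTop_iff {s : HahnSeries ℚ M} :
    0 ≤ s.orderTop ↔ ∀ e < 0, s.coeff e = 0 := by
  rw [HahnSeries.le_orderTop_iff_forall]
  exact ⟨fun h e he => h e (by exact_mod_cast he), fun h e he => h e (by exact_mod_cast he)⟩

lemma zero_le_orderTop_coeffDerivation (D : Derivation K M M) {s : HahnSeries ℚ M}
    (hs : 0 ≤ s.orderTop) : 0 ≤ (coeffDerivation D s).orderTop := by
  rw [zero_le_orderTop_iff] at hs ⊢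
  intro e he
  rw [coeffDerivation_coeff, hs e he, map_zero]

lemma zero_le_orderTop_heval {W : HahnSeries ℚ M} (hW : 0 < W.orderTop) (f : PowerSeries M) :
    0 ≤ (PowerSeries.heval W f).orderTop := by
  rw [zero_le_orderTop_iff]
  intro e he
  rw [PowerSeries.coeff_heval]
  refine finsum_eq_zero_of_forall_eq_zero fun n => ?_
  simp only [HahnSeries.SummableFamily.coeff_apply,
    HahnSeries.SummableFamily.powerSeriesFamily_of_orderTop_pos hW, HahnSeries.coeff_smul]
  have : 0 ≤ (W ^ n).orderTop :=
    (nsmul_nonneg hW.le n).trans HahnSeries.orderTop_nsmul_le_orderTop_pow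
  rw [zero_le_orderTop_iff.mp this e he, smul_zero]

/-- A Hahn series divisible by all powers of a series of positive order vanishes. -/
lemma eq_zero_of_forall_pow_dvd {W E : HahnSeries ℚ M} (hW : 0 < W.orderTop)
    (h : ∀ N : ℕ, ∃ g : HahnSeries ℚ M, 0 ≤ g.orderTop ∧ E = W ^ N * g) : E = 0 := by
  by_cases hW0 : W = 0
  · obtain ⟨g, -, hg⟩ := h 1
    rw [hg, hW0]; simp
  rw [HahnSeries.zero_lt_orderTop_iff hW0] at hW
  by_contra hE
  obtain ⟨N, hN⟩ := Archimedean.arch E.order hW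
  obtain ⟨g, hg0, hg⟩ := h (N + 1)
  have hg1 : g ≠ 0 := by
    rintro rfl
    exact hE (by rw [hg, mul_zero])
  have := congrArg HahnSeries.order hg
  rw [HahnSeries.order_mul (pow_ne_zero _ hW0) hg1, HahnSeries.order_pow, succ_nsmul] at this
  have := HahnSeries.zero_le_orderTop_iff.mp hg0
  linarith

/-- The chain rule for substitution into a power series with constant coefficients. -/
lemma coeffDerivation_heval (D : Derivation K M M) {W : HahnSeries ℚ M} (hW : 0 < W.orderTop)
    {f : PowerSeries M} (hf : ∀ n, D (f.coeff n) = 0) :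
    coeffDerivation D (PowerSeries.heval W f) =
      PowerSeries.heval W (PowerSeries.derivative M f) * coeffDerivation D W := by
  rw [← sub_eq_zero]
  -- Splitting off the constant term of `f` divides the difference of the two sides by `W`.
  refine eq_zero_of_forall_pow_dvd hW fun N => ?_
  induction N generalizing f with
  | zero =>
    refine ⟨_, ?_, (one_mul _).symm.trans (by rw [pow_zero])⟩
    rw [zero_le_orderTop_iff]
    intro e he
    rw [HahnSeries.coeff_sub, zero_le_orderTop_iff.mp (zero_le_orderTop_coeffDerivation D
      (zero_le_orderTop_heval hW f)) e he, zero_le_orderTop_iff.mp ?_ e he, sub_zero]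
    exact (add_nonneg (zero_le_orderTop_heval hW _)
      (zero_le_orderTop_coeffDerivation D hW.le)).trans HahnSeries.orderTop_add_le_mul
  | succ N ih =>
    obtain ⟨g, hg0, hg⟩ := ih (f := PowerSeries.mk fun n => f.coeff (n + 1))
      (fun n => by rw [PowerSeries.coeff_mk]; exact hf _)
    refine ⟨g, hg0, ?_⟩
    rw [pow_succ', mul_assoc, ← hg]
    have hX : PowerSeries.heval W PowerSeries.X = W := PowerSeries.heval_X W hW
    have hC : PowerSeries.heval W (PowerSeries.C (PowerSeries.constantCoeff f)) =
        HahnSeries.C (PowerSeries.constantCoeff f) := by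
      rw [PowerSeries.heval_C, ← HahnSeries.C_mul_eq_smul, mul_one]
    have h0 : D (PowerSeries.constantCoeff f) = 0 := by
      rw [← PowerSeries.coeff_zero_eq_constantCoeff_apply, hf]
    set g' := PowerSeries.mk fun n => f.coeff (n + 1) with hg'
    have hfg : f = PowerSeries.X * g' + PowerSeries.C (PowerSeries.constantCoeff f) :=
      PowerSeries.eq_X_mul_shift_add_const f
    conv_lhs => rw [hfg]
    rw [map_add, map_add, map_mul, hX, hC, map_add, coeffDerivation_C, h0]
    simp only [coeffDerivation_mul, Derivation.leibniz, PowerSeries.derivative_X,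
      PowerSeries.derivative_C, map_zero, smul_eq_mul, add_zero, map_add, map_mul, mul_one, hX]
    ring

lemma orderTop_div_single_sub_one_pos {s : HahnSeries ℚ M} (hs : s ≠ 0) :
    0 < (s / HahnSeries.single s.order s.leadingCoeff - 1).orderTop := by
  have hc0 : s.leadingCoeff ≠ 0 := HahnSeries.leadingCoeff_ne_zero.mpr hs
  have h1 : (HahnSeries.single s.order s.leadingCoeff)⁻¹ ≠ 0 :=
    inv_ne_zero (HahnSeries.single_ne_zero hc0)
  rw [HahnSeries.orderTop_self_sub_one_pos_iff, div_eq_mul_inv]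
  constructor
  · rw [HahnSeries.orderTop_mul, HahnSeries.inv_single, HahnSeries.orderTop_single (inv_ne_zero hc0),
      ← HahnSeries.order_eq_orderTop_of_ne_zero hs]
    norm_cast
    simp
  · rw [HahnSeries.leadingCoeff_mul, HahnSeries.inv_single, HahnSeries.leadingCoeff_of_single,
      mul_inv_cancel₀ hc0]

/-- The derivative of the modified logarithm of `s` is the logarithmic derivative of `s`. -/
lemma coeffDerivation_localLog [CharZero M] (D : Derivation K M M) (L : M → M)
    {s : HahnSeries ℚ M} (hs : s ≠ 0)
    (hL : D (L s.leadingCoeff) = D s.leadingCoeff / s.leadingCoeff) :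
    coeffDerivation D (localLog L s) = coeffDerivation D s / s := by
  set c := s.leadingCoeff with hc
  have hc0 : c ≠ 0 := HahnSeries.leadingCoeff_ne_zero.mpr hs
  set W := s / HahnSeries.single s.order c - 1 with hW
  have hT0 : HahnSeries.single s.order (1 : M) ≠ 0 := HahnSeries.single_ne_zero one_ne_zero
  have hs' : s = HahnSeries.C c * (HahnSeries.single s.order (1 : M) * (1 + W)) := by
    have : HahnSeries.single s.order c ≠ 0 := HahnSeries.single_ne_zero hc0
    rw [hW, add_sub_cancel, ← mul_assoc, HahnSeries.C_apply, HahnSeries.single_mul_single,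
      zero_add, mul_one, mul_div_cancel₀ _ this]
  have hWpos : 0 < W.orderTop := orderTop_div_single_sub_one_pos hs
  have hW1 : (1 + W) ≠ 0 := by
    intro h
    rw [h, mul_zero, mul_zero] at hs'
    exact hs hs'
  set f : PowerSeries M := PowerSeries.mk fun k : ℕ => (-1 : M) ^ (k + 1) / (k : M) with hf
  have hfc : ∀ n, D (f.coeff n) = 0 := by
    intro n
    have : f.coeff n = algebraMap K M ((-1) ^ (n + 1) / n) := by simp [hf]
    rw [this, Derivation.map_algebraMap]
  have hf' : (1 + PowerSeries.X) * PowerSeries.derivative M f = 1 := by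
    ext n
    rw [add_mul, one_mul, map_add, PowerSeries.coeff_derivative, PowerSeries.coeff_one, hf]
    rcases n with _ | n
    · simp
    · rw [PowerSeries.coeff_succ_X_mul, PowerSeries.coeff_derivative, PowerSeries.coeff_mk,
        PowerSeries.coeff_mk, if_neg (Nat.succ_ne_zero n)]
      have h1 : ((n : M) + 1) ≠ 0 := by exact_mod_cast Nat.succ_ne_zero n
      have h2 : ((n : M) + 1 + 1) ≠ 0 := by exact_mod_cast Nat.succ_ne_zero (n + 1)
      push_cast
      rw [div_mul_cancel₀ _ h2, div_mul_cancel₀ _ h1]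
      ring
  have h1 : (1 + W) * PowerSeries.heval W (PowerSeries.derivative M f) = 1 := by
    have := congrArg (PowerSeries.heval W) hf'
    rwa [map_mul, map_add, map_one, PowerSeries.heval_X W hWpos] at this
  have h2 : PowerSeries.heval W (PowerSeries.derivative M f) = (1 + W)⁻¹ :=
    eq_inv_of_mul_eq_one_right h1
  have h3 : coeffDerivation D (localLog L s) =
      HahnSeries.C (D c / c) + (1 + W)⁻¹ * coeffDerivation D W := by
    rw [localLog, map_add, coeffDerivation_C, hL, ← hc, ← hW, ← hf,
      coeffDerivation_heval D hWpos hfc, h2]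
  have h4 : coeffDerivation D s = HahnSeries.C (D c) * (HahnSeries.single s.order (1 : M) *
      (1 + W)) + HahnSeries.C c * (HahnSeries.single s.order (1 : M) * coeffDerivation D W) := by
    conv_lhs => rw [hs']
    rw [coeffDerivation_mul, coeffDerivation_mul, coeffDerivation_C, coeffDerivation_single]
    have h1 : coeffDerivation D (1 : HahnSeries ℚ M) = 0 := by
      rw [← HahnSeries.C_one, coeffDerivation_C, Derivation.map_one_eq_zero, HahnSeries.C_zero]
    simp only [Derivation.map_one_eq_zero, map_zero, map_add, h1]
    ring
  have hC0 : (HahnSeries.C c : HahnSeries ℚ M) ≠ 0 := HahnSeries.C_ne_zero hc0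
  rw [h3, h4, map_div₀, eq_div_iff hs]
  calc _ = (HahnSeries.C (D c) / HahnSeries.C c + (1 + W)⁻¹ * coeffDerivation D W) *
        (HahnSeries.C c * (HahnSeries.single s.order (1 : M) * (1 + W))) := by rw [← hs']
    _ = _ := by field_simp

end LogDerivative

/-! ### The theorem of Newton and Puiseux -/

section WeierstrassFactor

/-- Over a complete local ring, a monic polynomial whose reduction is divisible by the variable but
is not a power of it has a proper monic factor, namely the distinguished polynomial of the
Weierstrass preparation theorem. -/
lemma exists_monic_factor_of_isAdicComplete {A : Type*} [CommRing A] [IsLocalRing A]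
    [IsAdicComplete (IsLocalRing.maximalIdeal A) A] {Q : A[X]} (hQ : Q.Monic)
    (h0 : Q.coeff 0 ∈ IsLocalRing.maximalIdeal A) {j : ℕ} (hj : j < Q.natDegree)
    (hjQ : Q.coeff j ∉ IsLocalRing.maximalIdeal A) :
    ∃ G H : A[X], G.Monic ∧ H.Monic ∧ Q = G * H ∧ 0 < G.natDegree ∧
      G.natDegree < Q.natDegree := by
  set g : PowerSeries A := (Q : PowerSeries A) with hg
  have hcoeff : ∀ i, (g.map (IsLocalRing.residue A)).coeff i = 0 ↔
      Q.coeff i ∈ IsLocalRing.maximalIdeal A := by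
    intro i
    rw [PowerSeries.coeff_map, hg, Polynomial.coeff_coe, IsLocalRing.residue_eq_zero_iff]
  have hg0 : g.map (IsLocalRing.residue A) ≠ 0 := by
    intro h
    exact hjQ ((hcoeff j).mp (by rw [h, map_zero]))
  obtain ⟨G, u, hGu⟩ := PowerSeries.exists_isWeierstrassFactorization hg0
  have hGm : G.Monic := hGu.isDistinguishedAt.monic
  have hdeg := hGu.natDegree_eq_toNat_order_map
  have hlt : G.natDegree < Q.natDegree := by
    rw [hdeg]
    refine lt_of_le_of_lt ?_ hj
    have : (g.map (IsLocalRing.residue A)).order ≤ j :=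
      PowerSeries.order_le j fun h => hjQ ((hcoeff j).mp h)
    exact ENat.toNat_le_of_le_natCast this
  have hpos : 0 < G.natDegree := by
    rw [hdeg, Nat.pos_iff_ne_zero, Ne, ENat.toNat_eq_zero, not_or]
    refine ⟨fun h => ?_, fun h => hg0 (PowerSeries.order_eq_top.mp h)⟩
    have h1 := PowerSeries.coeff_order hg0
    rw [h] at h1
    exact h1 ((hcoeff 0).mpr h0)
  -- Both `Q = G v` and `Q = G (Q /ₘ G) + Q %ₘ G`, and the remainder of a Weierstrass division is
  -- unique.
  have hmod : Q %ₘ G = 0 := by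
    obtain ⟨v, rfl⟩ := hGu.isUnit
    have h1 : g * (((v⁻¹ : (PowerSeries A)ˣ) : PowerSeries A) *
        ((v : PowerSeries A) - ((Q /ₘ G : A[X]) : PowerSeries A))) =
          ((Q %ₘ G : A[X]) : PowerSeries A) := by
      have h2 : g = (G : PowerSeries A) * ((Q /ₘ G : A[X]) : PowerSeries A) +
          ((Q %ₘ G : A[X]) : PowerSeries A) := by
        rw [hg, ← Polynomial.coe_mul, ← Polynomial.coe_add, add_comm, modByMonic_add_div]
      have h3 : g = (G : PowerSeries A) * v := hGu.eq_mul
      have h4 : (v : PowerSeries A) * ((v⁻¹ : (PowerSeries A)ˣ) : PowerSeries A) = 1 :=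
        v.mul_inv
      linear_combination (v⁻¹ : (PowerSeries A)ˣ) * (v - (Q /ₘ G : A[X]) : PowerSeries A) * h3 +
        (G : PowerSeries A) * (v - (Q /ₘ G : A[X]) : PowerSeries A) * h4 + h2 - h3
    have hGd : G.degree = ((g.map (IsLocalRing.residue A)).order.toNat : WithBot ℕ) := by
      rw [← hdeg, degree_eq_natDegree hGm.ne_zero]
    exact ((PowerSeries.IsWeierstrassDivisor.of_map_ne_zero hg0).eq_zero_of_mul_eq
      (hGd ▸ degree_modByMonic_lt Q hGm) h1).2
  have hQG : Q = G * (Q /ₘ G) := by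
    conv_lhs => rw [← modByMonic_add_div Q G, hmod, zero_add]
  refine ⟨G, Q /ₘ G, hGm, ?_, hQG, hpos, hlt⟩
  exact hGm.of_mul_monic_left (hQG ▸ hQ)

end WeierstrassFactor

section Puiseux

variable (K M : Type*) [Field K] [Field M] [Algebra K M]

/-- The ring of Puiseux series with coefficients algebraic over `K`. -/
def puiseuxSubring : Subring (HahnSeries ℚ M) where
  carrier := {s | IsPuiseux K s}
  zero_mem' := ⟨⟨1, one_pos, by simp⟩, fun e => by simpa using isAlgebraic_zero⟩
  one_mem' := by
    refine ⟨⟨1, one_pos, fun e he => ⟨0, ?_⟩⟩, fun e => ?_⟩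
    · by_contra h
      exact he (by rw [HahnSeries.coeff_one, if_neg (by simpa using h)])
    · rw [HahnSeries.coeff_one]
      split_ifs
      exacts [isAlgebraic_one, isAlgebraic_zero]
  add_mem' := by
    rintro s t ⟨⟨h, hh, hs⟩, hs'⟩ ⟨⟨k, hk, ht⟩, ht'⟩
    have hh' : (h : ℚ) ≠ 0 := by exact_mod_cast hh.ne'
    have hk' : (k : ℚ) ≠ 0 := by exact_mod_cast hk.ne'
    refine ⟨⟨h * k, Nat.mul_pos hh hk, fun e he => ?_⟩, fun e => (hs' e).add (ht' e)⟩
    by_cases h0 : s.coeff e = 0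
    · have h1 : t.coeff e ≠ 0 := fun h1 => he (by rw [HahnSeries.coeff_add, h0, h1, add_zero])
      obtain ⟨j, hj⟩ := ht e h1
      refine ⟨j * h, ?_⟩
      rw [hj]; push_cast; field_simp
    · obtain ⟨j, hj⟩ := hs e h0
      refine ⟨j * k, ?_⟩
      rw [hj]; push_cast; field_simp
  neg_mem' := by
    rintro s ⟨⟨h, hh, hs⟩, hs'⟩
    exact ⟨⟨h, hh, fun e he => hs e (by simpa using he)⟩, fun e => (hs' e).neg⟩
  mul_mem' := by
    rintro s t ⟨⟨h, hh, hs⟩, hs'⟩ ⟨⟨k, hk, ht⟩, ht'⟩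
    have hh' : (h : ℚ) ≠ 0 := by exact_mod_cast hh.ne'
    have hk' : (k : ℚ) ≠ 0 := by exact_mod_cast hk.ne'
    refine ⟨⟨h * k, Nat.mul_pos hh hk, fun e he => ?_⟩, fun e => ?_⟩
    · obtain ⟨e₁, he₁, e₂, he₂, rfl⟩ := HahnSeries.support_mul_subset he
      obtain ⟨i, hi⟩ := hs e₁ he₁
      obtain ⟨j, hj⟩ := ht e₂ he₂
      refine ⟨i * k + j * h, ?_⟩
      simp only [hi, hj]
      push_cast
      field_simp
    · rw [HahnSeries.coeff_mul]
      refine mem_algebraicClosure_iff.mp (sum_mem fun ij _ => ?_)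
      exact mem_algebraicClosure_iff.mpr ((hs' _).mul (ht' _))

variable {K M}

lemma _root_.Polynomial.Monic.taylor {R : Type*} [CommRing R] {f : R[X]} (hf : f.Monic) (r : R) :
    (taylor r f).Monic := by
  rw [Monic, leadingCoeff_taylor, hf.leadingCoeff]

lemma single_mem_puiseuxSubring (e : ℚ) {c : M} (hc : IsAlgebraic K c) :
    HahnSeries.single e c ∈ puiseuxSubring K M := by
  refine ⟨⟨e.den, e.den_pos, fun e' he' => ⟨e.num, ?_⟩⟩, fun e' => ?_⟩
  · have : e' = e := by
      by_contra h
      exact he' (HahnSeries.coeff_single_of_ne h)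
    rw [this, Rat.num_div_den]
  · rw [HahnSeries.coeff_single]
    split_ifs
    exacts [hc, isAlgebraic_zero]

variable (K M) in
/-- The embedding of power series over the algebraic closure of `K` in `M` into Puiseux series that
sends the variable to `T ^ (1 / h)`. -/
def ramify {h : ℕ} (hh : 0 < h) : PowerSeries (algebraicClosure K M) →+* HahnSeries ℚ M :=
  (HahnSeries.embDomainRingHom (R := M)
    (({ toFun := fun n => (n : ℚ) / h
        map_zero' := by simp
        map_add' := fun a b => by push_cast; ring } : ℕ →+ ℚ))
    (fun a b hab => by
      have : (h : ℚ) ≠ 0 := by exact_mod_cast hh.ne'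
      exact_mod_cast (div_left_inj' this).mp hab)
    (fun a b => by
      have : (0 : ℚ) < h := by exact_mod_cast hh
      exact (div_le_div_iff_of_pos_right this).trans Nat.cast_le)).comp
  ((HahnSeries.toPowerSeries (R := M)).symm.toRingHom.comp
    (PowerSeries.map (algebraMap (algebraicClosure K M) M)))

lemma ramify_coeff {h : ℕ} (hh : 0 < h) (f : PowerSeries (algebraicClosure K M)) (n : ℕ) :
    (ramify K M hh f).coeff ((n : ℚ) / h) = algebraMap (algebraicClosure K M) M (f.coeff n) :=
  HahnSeries.embDomain_coeff

lemma ramify_coeff_of_ne {h : ℕ} (hh : 0 < h) (f : PowerSeries (algebraicClosure K M)) {e : ℚ}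
    (he : ∀ n : ℕ, e ≠ (n : ℚ) / h) : (ramify K M hh f).coeff e = 0 :=
  HahnSeries.embDomain_of_notMem_range fun ⟨n, hn⟩ => he n hn.symm

lemma ramify_mem {h : ℕ} (hh : 0 < h) (f : PowerSeries (algebraicClosure K M)) :
    ramify K M hh f ∈ puiseuxSubring K M := by
  refine ⟨⟨h, hh, fun e he => ?_⟩, fun e => ?_⟩
  · by_contra! hcon
    exact he (ramify_coeff_of_ne hh f fun n hn => hcon n (by rw [hn, Int.cast_natCast]))
  · by_cases hcon : ∃ n : ℕ, e = (n : ℚ) / h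
    · obtain ⟨n, rfl⟩ := hcon
      rw [ramify_coeff]
      exact mem_algebraicClosure_iff.mp (f.coeff n).2
    · push Not at hcon
      rw [ramify_coeff_of_ne hh f hcon]
      exact isAlgebraic_zero

lemma exists_ramify_eq {h : ℕ} (hh : 0 < h) {s : HahnSeries ℚ M}
    (hs : ∀ e ∈ s.support, ∃ j : ℤ, e = (j : ℚ) / h) (hs' : ∀ e, IsAlgebraic K (s.coeff e))
    (h0 : ∀ e < 0, s.coeff e = 0) : ∃ f, ramify K M hh f = s := by
  refine ⟨PowerSeries.mk fun n =>
    ⟨s.coeff ((n : ℚ) / h), mem_algebraicClosure_iff.mpr (hs' _)⟩, ?_⟩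
  ext e
  by_cases hcon : ∃ n : ℕ, e = (n : ℚ) / h
  · obtain ⟨n, rfl⟩ := hcon
    rw [ramify_coeff, PowerSeries.coeff_mk]
    rfl
  · push Not at hcon
    rw [ramify_coeff_of_ne hh _ hcon]
    by_contra hne
    obtain ⟨j, hj⟩ := hs e (Ne.symm hne)
    rcases lt_or_ge j 0 with hj0 | hj0
    · refine hne (h0 e ?_).symm
      rw [hj]
      exact div_neg_of_neg_of_pos (by exact_mod_cast hj0) (by exact_mod_cast hh)
    · lift j to ℕ using hj0
      exact hcon j (by rw [hj, Int.cast_natCast])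

/-- The embedding `ramify` with values in the ring of Puiseux series. -/
def ramifyPuiseux {h : ℕ} (hh : 0 < h) :
    PowerSeries (algebraicClosure K M) →+* puiseuxSubring K M :=
  (ramify K M hh).codRestrict _ (ramify_mem hh)

lemma exists_common_denominator (P : (puiseuxSubring K M)[X]) :
    ∃ h : ℕ, 0 < h ∧ ∀ i, ∀ e ∈ ((P.coeff i : puiseuxSubring K M) : HahnSeries ℚ M).support,
      ∃ j : ℤ, e = (j : ℚ) / h := by
  have h1 : ∀ i, ∃ h : ℕ, 0 < h ∧
      ∀ e ∈ ((P.coeff i : puiseuxSubring K M) : HahnSeries ℚ M).support,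
        ∃ j : ℤ, e = (j : ℚ) / h := fun i => (P.coeff i).2.1
  choose h hpos hh using h1
  refine ⟨∏ i ∈ P.support, h i, Finset.prod_pos fun i _ => hpos i, fun i e he => ?_⟩
  have hi : i ∈ P.support := by
    rw [mem_support_iff]
    intro h0
    rw [h0] at he
    exact he (by simp)
  obtain ⟨j, hj⟩ := hh i e he
  have h2 : (h i : ℚ) ≠ 0 := by exact_mod_cast (hpos i).ne'
  have h3 : (∏ k ∈ P.support.erase i, (h k : ℚ)) ≠ 0 :=
    Finset.prod_ne_zero_iff.mpr fun k _ => by exact_mod_cast (hpos k).ne'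
  refine ⟨j * ∏ k ∈ P.support.erase i, (h k : ℤ), ?_⟩
  rw [hj, ← Finset.mul_prod_erase _ _ hi]
  push_cast
  field_simp

/-- The case of integral coefficients: if the reduction modulo positive exponents has no term of
degree `n - 1` and is not a power of the variable, then the polynomial has a proper factor. -/
lemma exists_monic_factor_of_integral [CharZero M] [IsAlgClosed M] {P : (puiseuxSubring K M)[X]}
    (hP : P.Monic) (hn : 2 ≤ P.natDegree)
    (hint : ∀ i, ∀ e < 0, ((P.coeff i : puiseuxSubring K M) : HahnSeries ℚ M).coeff e = 0)
    (hsub : P.coeff (P.natDegree - 1) = 0) {i₀ : ℕ} (hi₀ : i₀ < P.natDegree)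
    (hne : ((P.coeff i₀ : puiseuxSubring K M) : HahnSeries ℚ M).coeff 0 ≠ 0) :
    ∃ a : puiseuxSubring K M, ∃ G H : (puiseuxSubring K M)[X], G.Monic ∧ H.Monic ∧
      taylor a P = G * H ∧ 0 < G.natDegree ∧ G.natDegree < P.natDegree := by
  set k := algebraicClosure K M
  have : IsAlgClosed k := IsAlgClosure.isAlgClosed K
  obtain ⟨h, hh, hden⟩ := exists_common_denominator P
  have hlift : P ∈ lifts (ramifyPuiseux (K := K) (M := M) hh) := by
    rw [lifts_iff_coeff_lifts]
    intro i
    obtain ⟨f, hf⟩ := exists_ramify_eq (K := K) hh (hden i) (P.coeff i).2.2 (hint i)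
    exact ⟨f, Subtype.ext hf⟩
  obtain ⟨Q, hQP, hQdeg, hQm⟩ := lifts_and_natDegree_eq_and_monic hlift hP
  set q : k[X] := Q.map PowerSeries.constantCoeff with hq
  have hqm : q.Monic := hQm.map _
  have hqdeg : q.natDegree = P.natDegree := by rw [hq, hQm.natDegree_map, hQdeg]
  have hqc : ∀ i, algebraMap k M (q.coeff i) =
      ((P.coeff i : puiseuxSubring K M) : HahnSeries ℚ M).coeff 0 := by
    intro i
    have h1 := ramify_coeff hh (Q.coeff i) 0
    rw [Nat.cast_zero, zero_div] at h1
    rw [hq, coeff_map, ← PowerSeries.coeff_zero_eq_constantCoeff_apply, ← h1, ← hQP, coeff_map]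
    rfl
  obtain ⟨c, hc⟩ := IsAlgClosed.exists_root q (by
    rw [degree_eq_natDegree hqm.ne_zero, hqdeg]
    exact_mod_cast (by omega : P.natDegree ≠ 0))
  set Q' := taylor (PowerSeries.C c) Q with hQ'
  have hQ'm : Q'.Monic := hQm.taylor _
  have hQ'deg : Q'.natDegree = P.natDegree := by rw [hQ', natDegree_taylor, hQdeg]
  have hmap : Q'.map PowerSeries.constantCoeff = taylor c q := by
    rw [hQ', hq, taylor_apply, taylor_apply, Polynomial.map_comp]
    simp
  have hmem : ∀ i, Q'.coeff i ∈ IsLocalRing.maximalIdeal (PowerSeries k) ↔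
      (taylor c q).coeff i = 0 := by
    intro i
    rw [PowerSeries.maximalIdeal_eq_span_X, Ideal.mem_span_singleton, PowerSeries.X_dvd_iff,
      ← hmap, coeff_map]
  have hex : ∃ j < Q'.natDegree, Q'.coeff j ∉ IsLocalRing.maximalIdeal (PowerSeries k) := by
    by_contra! hall
    have h1 : taylor c q = X ^ P.natDegree := by
      have hm : (taylor c q).Monic := hqm.taylor c
      have hd : (taylor c q).natDegree = P.natDegree := by rw [natDegree_taylor, hqdeg]
      ext1 i
      rw [coeff_X_pow]
      rcases lt_trichotomy i P.natDegree with hi | rfl | hi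
      · rw [if_neg hi.ne, ← hmem]
        exact hall i (hQ'deg ▸ hi)
      · rw [if_pos rfl, ← hd]
        exact hm.coeff_natDegree
      · rw [if_neg hi.ne', coeff_eq_zero_of_natDegree_lt (hd ▸ hi)]
    have h2 : q = (X - C c) ^ P.natDegree := by
      have := congrArg (taylor (-c)) h1
      rw [taylor_taylor] at this
      simpa [sub_eq_add_neg] using this
    have h3 : q.coeff (P.natDegree - 1) = 0 := by
      have := hqc (P.natDegree - 1)
      rw [hsub] at this
      simpa using this
    -- In characteristic zero, `(X - c) ^ n` has no term of degree `n - 1` only for `c = 0`.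
    have hc0 : c = 0 := by
      rw [h2, sub_eq_add_neg, ← C_neg, coeff_X_add_C_pow] at h3
      have h4 : P.natDegree - (P.natDegree - 1) = 1 := by omega
      have h5 : P.natDegree.choose (P.natDegree - 1) = P.natDegree := by
        rw [Nat.choose_symm_of_eq_add (b := 1) (by omega), Nat.choose_one_right]
      rw [h4, h5, pow_one, mul_eq_zero, neg_eq_zero] at h3
      refine h3.resolve_right ?_
      exact_mod_cast (by omega : P.natDegree ≠ 0)
    have h4 : q.coeff i₀ = 0 := by
      rw [h2, hc0, C_0, sub_zero, coeff_X_pow, if_neg hi₀.ne]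
    exact hne (by rw [← hqc, h4, map_zero])
  obtain ⟨j, hj, hjQ⟩ := hex
  have : IsAdicComplete (IsLocalRing.maximalIdeal (PowerSeries k)) (PowerSeries k) := by
    rw [PowerSeries.maximalIdeal_eq_span_X]; infer_instance
  obtain ⟨G, H, hG, hH, hGH, h1, h2⟩ := exists_monic_factor_of_isAdicComplete hQ'm
    ((hmem 0).mpr (by rw [taylor_coeff_zero]; exact hc)) hj hjQ
  refine ⟨ramifyPuiseux hh (PowerSeries.C c), G.map (ramifyPuiseux hh), H.map (ramifyPuiseux hh),
    hG.map _, hH.map _, ?_, ?_, ?_⟩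
  · rw [← Polynomial.map_mul, ← hGH, hQ', ← hQP, taylor_apply, taylor_apply, Polynomial.map_comp]
    simp
  · rwa [hG.natDegree_map]
  · rwa [hG.natDegree_map, ← hQ'deg]

/-- Newton–Puiseux: monic polynomials over the ring of Puiseux series split. -/
theorem splits_of_monic_puiseuxSubring [CharZero M] [IsAlgClosed M]
    {P : (puiseuxSubring K M)[X]} (hP : P.Monic) : P.Splits := by
  classical
  induction hn : P.natDegree using Nat.strong_induction_on generalizing P with
  | _ n ih =>
  rcases Nat.lt_or_ge n 2 with hn2 | hn2
  · exact Splits.of_natDegree_le_one_of_monic (by omega) hP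
  -- Remove the term of degree `n - 1` by a translation.
  have hn0 : (n : M) ≠ 0 := by exact_mod_cast (by omega : n ≠ 0)
  set w : puiseuxSubring K M := ⟨HahnSeries.single 0 (n : M)⁻¹,
    single_mem_puiseuxSubring 0 (isAlgebraic_natCast n).inv⟩ with hw
  have hw1 : (n : puiseuxSubring K M) * w = 1 := by
    refine Subtype.ext ?_
    push_cast
    rw [hw, ← HahnSeries.single_zero_natCast, HahnSeries.single_mul_single, add_zero,
      mul_inv_cancel₀ hn0]
    rfl
  set r := -(w * P.coeff (n - 1)) with hr
  have hm1 : (taylor r P).Monic := hP.taylor r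
  have hd1 : (taylor r P).natDegree = n := by rw [natDegree_taylor, hn]
  have hsub : (taylor r P).coeff (n - 1) = 0 := by
    have h1 : (hasseDeriv (n - 1) P).natDegree < 2 :=
      lt_of_le_of_lt (natDegree_hasseDeriv_le P (n - 1)) (by omega)
    rw [taylor_coeff, eval_eq_sum_range' h1, Finset.sum_range_succ, Finset.sum_range_one,
      hasseDeriv_coeff, hasseDeriv_coeff, zero_add, Nat.choose_self,
      show 1 + (n - 1) = n by omega, Nat.choose_symm_of_eq_add (b := 1) (by omega),
      Nat.choose_one_right, ← hn, hP.coeff_natDegree, hn, hr]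
    linear_combination (- P.coeff (n - 1)) * hw1
  suffices h : (taylor r P).Splits by
    have := h.taylor (-r)
    rwa [taylor_taylor, neg_add_cancel, taylor_zero] at this
  set P₁ := taylor r P with hP₁
  clear_value P₁ r w
  by_cases hall : ∀ i < n, P₁.coeff i = 0
  · have : P₁ = X ^ n := by
      ext1 i
      rw [coeff_X_pow]
      rcases lt_trichotomy i n with hi | rfl | hi
      · rw [if_neg hi.ne, hall i hi]
      · rw [if_pos rfl, ← hd1]
        exact hm1.coeff_natDegree
      · rw [if_neg hi.ne', coeff_eq_zero_of_natDegree_lt (hd1 ▸ hi)]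
    rw [this]
    exact Splits.X_pow n
  push Not at hall
  -- The index `i₀` realizes the least slope `ρ` of the Newton polygon. Multiplying the roots by
  -- `T ^ (-ρ)` makes all coefficients integral, and the one of index `i₀` gets a constant term.
  let S : Finset ℕ := (Finset.range n).filter fun i => P₁.coeff i ≠ 0
  have hS : S.Nonempty := by
    obtain ⟨i, hi, hi'⟩ := hall
    exact ⟨i, Finset.mem_filter.mpr ⟨Finset.mem_range.mpr hi, hi'⟩⟩
  obtain ⟨i₀, hi₀S, hmin⟩ := S.exists_min_image (fun i =>
    ((P₁.coeff i : puiseuxSubring K M) : HahnSeries ℚ M).order / ((n : ℚ) - i)) hS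
  obtain ⟨hi₀, hi₀'⟩ := Finset.mem_filter.mp hi₀S
  rw [Finset.mem_range] at hi₀
  set ρ : ℚ := ((P₁.coeff i₀ : puiseuxSubring K M) : HahnSeries ℚ M).order / ((n : ℚ) - i₀)
    with hρ
  let T (e : ℚ) : puiseuxSubring K M :=
    ⟨HahnSeries.single e 1, single_mem_puiseuxSubring e isAlgebraic_one⟩
  have hT : T (-ρ) * T ρ = 1 := by
    refine Subtype.ext ?_
    change HahnSeries.single (-ρ) (1 : M) * HahnSeries.single ρ (1 : M) = 1
    rw [HahnSeries.single_mul_single, neg_add_cancel, mul_one]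
    rfl
  set P₂ := P₁.scaleRoots (T (-ρ)) with hP₂
  suffices h : P₂.Splits by
    have := h.scaleRoots (T ρ)
    rwa [hP₂, ← scaleRoots_mul, hT, scaleRoots_one] at this
  have hm2 : P₂.Monic := (monic_scaleRoots_iff _).mpr hm1
  have hd2 : P₂.natDegree = n := by rw [hP₂, natDegree_scaleRoots, hd1]
  have hc2 : ∀ i < n, ∀ e : ℚ, ((P₂.coeff i : puiseuxSubring K M) : HahnSeries ℚ M).coeff e =
      ((P₁.coeff i : puiseuxSubring K M) : HahnSeries ℚ M).coeff (e + ((n : ℚ) - i) * ρ) := by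
    intro i hi e
    have h1 : (((T (-ρ)) ^ (n - i) : puiseuxSubring K M) : HahnSeries ℚ M) =
        HahnSeries.single (-(((n : ℚ) - i) * ρ)) 1 := by
      change (HahnSeries.single (-ρ) (1 : M)) ^ (n - i) = _
      rw [HahnSeries.single_pow, one_pow, nsmul_eq_mul, Nat.cast_sub hi.le, mul_neg]
    rw [hP₂, coeff_scaleRoots, hd1]
    push_cast [h1]
    rw [HahnSeries.coeff_mul_single, mul_one, sub_neg_eq_add]
  have hpos : ∀ i < n, (0 : ℚ) < (n : ℚ) - i := fun i hi => by
    have : (i : ℚ) < n := by exact_mod_cast hi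
    linarith
  obtain ⟨a, G, H, hG, hH, hGH, hG0, hGn⟩ := exists_monic_factor_of_integral hm2 (hd2.symm ▸ hn2)
    (fun i e he => by
      rcases lt_trichotomy i n with hi | rfl | hi
      · rw [hc2 i hi]
        by_cases hi0 : P₁.coeff i = 0
        · rw [hi0]; simp
        have h1 := hmin i (Finset.mem_filter.mpr ⟨Finset.mem_range.mpr hi, hi0⟩)
        rw [le_div_iff₀ (hpos i hi)] at h1
        refine HahnSeries.coeff_eq_zero_of_lt_order (lt_of_lt_of_le ?_ h1)
        linarith
      · rw [← hd2, hm2.coeff_natDegree]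
        change (1 : HahnSeries ℚ M).coeff e = 0
        rw [HahnSeries.coeff_one, if_neg he.ne]
      · rw [coeff_eq_zero_of_natDegree_lt (hd2 ▸ hi)]; simp)
    (by rw [hd2, hP₂, coeff_scaleRoots, hsub, zero_mul]) (hd2.symm ▸ hi₀)
    (by
      rw [hc2 i₀ hi₀, zero_add, hρ, mul_div_cancel₀ _ (hpos i₀ hi₀).ne']
      exact HahnSeries.coeff_order_eq_zero.not.mpr fun h => hi₀' (Subtype.ext h))
  have hdeg : G.natDegree + H.natDegree = n := by
    rw [← hG.natDegree_mul hH, ← hGH, natDegree_taylor, hd2]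
  have h := ((ih _ (by omega) hG rfl).mul (ih _ (by omega) hH rfl)).taylor (-a)
  rwa [← hGH, taylor_taylor, neg_add_cancel, taylor_zero] at h

end Puiseux

/-! ### Differential extensions with logarithms -/

section Derivations

variable {R S T : Type*} [CommRing R] [CommRing S] [CommRing T] [Algebra R T] [Algebra S T]

/-- Derivations extend along formally étale algebras. -/
lemma exists_derivation_of_formallyEtale [Algebra R S] [IsScalarTower R S T]
    [Algebra.FormallyEtale S T] (d : Derivation R S T) :
    ∃ D : Derivation R T T, ∀ s : S, D (algebraMap S T s) = d s := by
  refine ⟨((LinearMap.liftBaseChange T d.liftKaehlerDifferential) ∘ₗ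
    (KaehlerDifferential.tensorKaehlerEquivOfFormallyEtale R S T).symm.toLinearMap).compDer
      (KaehlerDifferential.D R T), fun s => ?_⟩
  simp [KaehlerDifferential.tensorKaehlerEquivOfFormallyEtale_symm_D_algebraMap]

lemma derivation_ext_of_formallyUnramified [Algebra.FormallyUnramified S T]
    {D₁ D₂ : Derivation R T T} (h : ∀ s : S, D₁ (algebraMap S T s) = D₂ (algebraMap S T s)) :
    D₁ = D₂ := by
  have h0 : ∀ s : S, (D₁ - D₂) (algebraMap S T s) = 0 := fun s => by
    rw [Derivation.sub_apply, h, sub_self]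
  let E : Derivation S T T := Derivation.mk'
    { toFun := D₁ - D₂
      map_add' := (D₁ - D₂).map_add
      map_smul' := fun s t => by
        change (D₁ - D₂) (s • t) = s • (D₁ - D₂) t
        rw [Algebra.smul_def, Derivation.leibniz, h0, smul_zero, add_zero,
          smul_eq_mul, Algebra.smul_def] }
    fun x y => (D₁ - D₂).leibniz x y
  have hE : E = 0 := by
    have : E.liftKaehlerDifferential = 0 :=
      LinearMap.ext fun w => by rw [Subsingleton.elim w 0, map_zero, map_zero]
    rw [← E.liftKaehlerDifferential_comp, this]
    ext; simp
  ext t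
  have : E t = 0 := by rw [hE]; rfl
  exact sub_eq_zero.mp this

end Derivations

/-- A derivation kills the algebraic elements. -/
lemma derivation_eq_zero_of_isAlgebraic {K M : Type*} [Field K] [Field M] [Algebra K M]
    [CharZero K] (D : Derivation K M M) {z : M} (hz : IsAlgebraic K z) : D z = 0 := by
  have h1 := congrArg D (minpoly.aeval K z)
  rw [map_zero, Derivation.map_aeval, smul_eq_mul] at h1
  exact (mul_eq_zero.mp h1).resolve_left
    (Separable.aeval_derivative_ne_zero (minpoly.irreducible hz.isIntegral).separable
      (minpoly.aeval K z))

lemma exists_algebraMap_eq_of_isAlgebraic {K k M : Type*} [Field K] [Field k] [Field M]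
    [Algebra K k] [Algebra K M] [Algebra k M] [IsScalarTower K k M] [IsAlgClosed k] {z : M}
    (hz : IsAlgebraic K z) : ∃ c : k, algebraMap k M c = z := by
  have hz' : IsIntegral k z := (hz.tower_top k).isIntegral
  exact minpoly.mem_range_of_degree_eq_one k z
    (IsAlgClosed.degree_eq_one_of_irreducible k (minpoly.irreducible hz'))

/-- Given a formally étale extension `M` of a polynomial ring over the algebraically closed field
`k` with one indeterminate for each `a i` and one for the logarithm of each affine form in the
`a i`, the field `M` has the structure of a differential extension with all logarithms. -/
lemma exists_derivations_and_logarithms {K k M : Type*} [Field K] [Field k] [Field M] [Algebra K k]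
    [Algebra K M] [Algebra k M] [IsScalarTower K k M] [IsAlgClosed k] {m : ℕ}
    [Algebra (MvPolynomial (Fin m ⊕ (k × (Fin m → k))) k) M]
    [IsScalarTower k (MvPolynomial (Fin m ⊕ (k × (Fin m → k))) k) M]
    [Algebra.FormallyEtale (MvPolynomial (Fin m ⊕ (k × (Fin m → k))) k) M]
    (hinj : Function.Injective
      (algebraMap (MvPolynomial (Fin m ⊕ (k × (Fin m → k))) k) M)) :
    ∃ (a : Fin m → M) (D : Fin m → Derivation K M M) (L : M → M),
      IsDifferentialExtension K a D ∧ IsLogOn D L {c | c ∈ affineForms K a ∧ c ≠ 0} := by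
  classical
  let ι := Fin m ⊕ (k × (Fin m → k))
  let x : ι → M := fun t => algebraMap (MvPolynomial ι k) M (MvPolynomial.X t)
  let a : Fin m → M := fun i => x (Sum.inl i)
  let form : k × (Fin m → k) → M := fun t =>
    algebraMap k M t.1 + ∑ i, algebraMap k M (t.2 i) * a i
  let v : Fin m → ι → M := fun i => Sum.elim (fun j => if i = j then 1 else 0)
    (fun t => algebraMap k M (t.2 i) / form t)
  have hD : ∀ i, ∃ D : Derivation k M M, ∀ t, D (x t) = v i t := by
    intro i
    obtain ⟨D, hD⟩ := exists_derivation_of_formallyEtale (T := M)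
      (MvPolynomial.mkDerivation k (v i) : Derivation k (MvPolynomial ι k) M)
    exact ⟨D, fun t => by rw [hD, MvPolynomial.mkDerivation_X]⟩
  choose D hD using hD
  have hDa : ∀ i j, D i (a j) = if i = j then 1 else 0 := fun i j => hD i (Sum.inl j)
  have hDform : ∀ i t, D i (form t) = algebraMap k M (t.2 i) := by
    intro i t
    simp only [form, map_add, map_sum, Derivation.leibniz, Derivation.map_algebraMap, hDa,
      zero_add, smul_eq_mul]
    simp
  -- A derivation of `M` is determined by its values on the indeterminates, so that it is enough to
  -- compare the commutators there.
  have hext : ∀ D₁ D₂ : Derivation k M M, (∀ t, D₁ (x t) = D₂ (x t)) → D₁ = D₂ := by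
    intro D₁ D₂ h
    refine derivation_ext_of_formallyUnramified (S := MvPolynomial ι k) fun s => ?_
    have : D₁.compAlgebraMap (MvPolynomial ι k) = D₂.compAlgebraMap (MvPolynomial ι k) :=
      MvPolynomial.derivation_ext h
    exact congrArg (fun E : Derivation k (MvPolynomial ι k) M => E s) this
  have hcomm : ∀ i j, ⁅D i, D j⁆ = 0 := by
    intro i j
    refine hext _ _ fun t => ?_
    rw [Derivation.commutator_apply, Derivation.zero_apply, sub_eq_zero, hD, hD]
    rcases t with l | t
    · simp only [v, Sum.elim_inl]
      split_ifs <;> simp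
    · simp only [v, Sum.elim_inr, Derivation.leibniz_div, hDform, Derivation.map_algebraMap,
        smul_eq_mul, mul_zero, zero_sub]
      rw [mul_comm (algebraMap k M (t.2 i))]
  -- Logarithms are indexed by the coefficients of affine forms; `L` chooses one for each value.
  let L : M → M := fun c => if h : ∃ t, form t = c then x (Sum.inr h.choose) else 0
  refine ⟨a, fun i => (D i).restrictScalars K, L, ⟨?_, hDa, fun i j z => ?_⟩, ?_⟩
  · have h1 : AlgebraicIndependent k x :=
      (MvPolynomial.algebraicIndependent_X ι k).map'
        (f := IsScalarTower.toAlgHom k (MvPolynomial ι k) M) hinj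
    exact (h1.comp _ Sum.inl_injective).restrictScalars (algebraMap K k).injective
  · have := congrArg (fun E : Derivation k M M => E z) (hcomm i j)
    simpa [Derivation.commutator_apply, sub_eq_zero] using this
  · rintro c ⟨⟨c₀, c', hc₀, hc', hc⟩, hne⟩ i
    obtain ⟨d₀, rfl⟩ := exists_algebraMap_eq_of_isAlgebraic (k := k) hc₀
    choose d hd using fun i => exists_algebraMap_eq_of_isAlgebraic (k := k) (hc' i)
    have hex : ∃ t, form t = c := ⟨(d₀, d), by simp only [form, hd]; exact hc.symm⟩
    change D i (L c) = D i c / c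
    have h1 : L c = x (Sum.inr hex.choose) := dif_pos hex
    have h2 : form hex.choose = c := hex.choose_spec
    rw [h1, hD]
    conv_rhs => rw [← h2, hDform]
    simp only [v, Sum.elim_inr]

/-- There is an algebraically closed differential extension of `K(a)` with all logarithms of affine
forms: the algebraic closure of a purely transcendental extension. -/
theorem exists_differentialExtension (K : Type) [Field K] [CharZero K] (m : ℕ) :
    ∃ (M : Type) (_ : Field M) (_ : Algebra K M) (_ : IsAlgClosed M) (a : Fin m → M)
      (D : Fin m → Derivation K M M) (L : M → M),
      IsDifferentialExtension K a D ∧ IsLogOn D L {c | c ∈ affineForms K a ∧ c ≠ 0} := by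
  let k := AlgebraicClosure K
  let P := MvPolynomial (Fin m ⊕ (k × (Fin m → k))) k
  let F := FractionRing P
  let M := AlgebraicClosure F
  have : IsScalarTower K k M := inferInstance
  have : CharZero k := charZero_of_injective_algebraMap (algebraMap K k).injective
  have : CharZero F := charZero_of_injective_algebraMap (algebraMap k F).injective
  have : Algebra.FormallyEtale P F := Algebra.FormallyEtale.of_isLocalization (nonZeroDivisors P)
  have : Algebra.FormallyEtale F M := Algebra.FormallyEtale.of_isSeparable F M
  have : Algebra.FormallyEtale P M := Algebra.FormallyEtale.comp P F M
  have hinj : Function.Injective (algebraMap P M) := by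
    rw [IsScalarTower.algebraMap_eq P F M]
    exact (algebraMap F M).injective.comp (IsFractionRing.injective P F)
  exact ⟨M, inferInstance, inferInstance, inferInstance,
    exists_derivations_and_logarithms (K := K) (k := k) hinj⟩

/-! ### Evaluation of bivariate polynomials -/

section Eval

variable {R N : Type*} [CommRing R] [CommRing N] [Algebra R N]

lemma aevalAeval_eq_eval_map (x y : N) (P : R[X][X]) :
    aevalAeval x y P = (P.map (aeval x : R[X] →ₐ[R] N).toRingHom).eval y := by
  have h : (aevalAeval x y : R[X][X] →ₐ[R] N).toRingHom =
      (evalRingHom y).comp (mapRingHom (aeval x : R[X] →ₐ[R] N).toRingHom) := by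
    ext <;> simp
  exact congrArg (fun φ : R[X][X] →+* N => φ P) h

lemma aevalAeval_map_map {S : Type*} [CommRing S] [Algebra S R] [Algebra S N] [IsScalarTower S R N]
    (x y : N) (P : S[X][X]) :
    aevalAeval x y (P.map (mapRingHom (algebraMap S R))) = aevalAeval x y P := by
  have h : (aevalAeval x y : R[X][X] →ₐ[R] N).toRingHom.comp
      (mapRingHom (mapRingHom (algebraMap S R))) =
      (aevalAeval x y : S[X][X] →ₐ[S] N).toRingHom := by
    ext <;> simp [← IsScalarTower.algebraMap_apply]
  exact congrArg (fun φ : S[X][X] →+* N => φ P) h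

end Eval

/-! ### Coefficientwise derivations -/

section Coefficientwise

variable {R N : Type*} [CommRing R] [CommRing N]

lemma coeff_sum_monomial_apply (d : R →+ R) (P : R[X]) (n : ℕ) :
    (∑ i ∈ P.support, monomial i (d (P.coeff i))).coeff n = d (P.coeff n) := by
  simp only [finsetSum_coeff, coeff_monomial]
  rw [Finset.sum_ite_eq' P.support n]
  split_ifs with hn
  · rfl
  · rw [notMem_support_iff.mp hn, map_zero]

/-- The additive map `d`, applied to each coefficient of a polynomial. -/
def coeffwise (d : R →+ R) : R[X] →+ R[X] where
  toFun P := ∑ n ∈ P.support, monomial n (d (P.coeff n))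
  map_zero' := by simp
  map_add' P Q := by
    ext n
    rw [coeff_add, coeff_sum_monomial_apply, coeff_sum_monomial_apply, coeff_sum_monomial_apply,
      coeff_add, map_add]

lemma coeff_coeffwise (d : R →+ R) (P : R[X]) (n : ℕ) :
    (coeffwise d P).coeff n = d (P.coeff n) :=
  coeff_sum_monomial_apply d P n

lemma coeffwise_mul {d : R →+ R} (hd : ∀ a b, d (a * b) = a * d b + b * d a) (P Q : R[X]) :
    coeffwise d (P * Q) = P * coeffwise d Q + Q * coeffwise d P := by
  ext n
  rw [coeff_coeffwise, coeff_add, mul_comm Q, coeff_mul, coeff_mul, coeff_mul, map_sum,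
    ← Finset.sum_add_distrib]
  refine Finset.sum_congr rfl fun i _ => ?_
  rw [hd, coeff_coeffwise, coeff_coeffwise, mul_comm (d _)]

lemma coeffwise_eq_zero {d : R →+ R} {P : R[X]} (h : ∀ n, d (P.coeff n) = 0) :
    coeffwise d P = 0 := by
  ext n
  rw [coeff_coeffwise, h, coeff_zero]

lemma coeffwise_C (d : R →+ R) (c : R) : coeffwise d (C c) = C (d c) := by
  ext n
  rw [coeff_coeffwise, coeff_C, coeff_C]
  split_ifs <;> simp

/-- The chain rule for a derivation `δ` of `N` that restricts to the derivation `d` of `R`. -/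
lemma apply_eval₂_eq {d : R →+ R} {δ : N →+ N} (φ : R →+* N) (h : ∀ c, δ (φ c) = φ (d c))
    (hδ : ∀ a b, δ (a * b) = a * δ b + b * δ a) (y : N) (P : R[X]) :
    δ (P.eval₂ φ y) = (coeffwise d P).eval₂ φ y + P.derivative.eval₂ φ y * δ y := by
  have h1 : δ 1 = 0 := by
    have := hδ 1 1
    rw [mul_one, one_mul] at this
    exact left_eq_add.mp this
  have hpow : ∀ n : ℕ, δ (y ^ n) = n * y ^ (n - 1) * δ y := by
    intro n
    induction n with
    | zero => simp [h1]
    | succ n ih =>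
      rw [pow_succ, hδ, ih]
      rcases n with _ | n
      · simp
      · simp only [Nat.add_sub_cancel, Nat.cast_add, Nat.cast_one, pow_succ]
        ring
  induction P using Polynomial.induction_on' with
  | add P Q hP hQ =>
    simp only [map_add, eval₂_add, hP, hQ]
    ring
  | monomial n c =>
    have : coeffwise d (monomial n c) = monomial n (d c) := by
      ext k
      rw [coeff_coeffwise, coeff_monomial, coeff_monomial]
      split_ifs <;> simp
    rw [this, derivative_monomial, eval₂_monomial, eval₂_monomial, eval₂_monomial, hδ, hpow, h,
      map_mul, map_natCast]
    ring

end Coefficientwise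

/-! ### Sums over the roots of a monic polynomial -/

section Trace

variable {R N : Type*} [CommRing R] [Field N]

/-- Euler's formula: for `c` of degree `n` with distinct roots `y`, the sum of `P(y) / c'(y)` is the
coefficient of degree `n - 1` of the remainder of `P` modulo `c`. -/
lemma sum_roots_eval_div_derivative {c : N[X]} (hc : c.Monic) (hs : c.Splits)
    (hn : c.roots.Nodup) (P : N[X]) :
    (c.roots.map fun y => P.eval y / c.derivative.eval y).sum =
      (P %ₘ c).coeff (c.natDegree - 1) := by
  classical
  have hcard : c.roots.toFinset.card = c.natDegree := by
    rw [Multiset.toFinset_card_of_nodup hn, hs.natDegree_eq_card_roots]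
  have hdeg : (P %ₘ c).degree < (c.roots.toFinset.card : WithBot ℕ) := by
    rw [hcard]
    exact (degree_modByMonic_lt P hc).trans_le degree_le_natDegree
  have := Lagrange.coeff_eq_sum (v := id) (Set.injOn_id _) hdeg
  rw [hcard] at this
  rw [this, Finset.sum_eq_multiset_sum, Multiset.toFinset_val, hn.dedup]
  refine congrArg _ (Multiset.map_congr rfl fun y hy => ?_)
  have hy0 : c.eval y = 0 := (mem_roots hc.ne_zero).mp hy
  have hP : P.eval y = (P %ₘ c).eval y := by
    conv_lhs => rw [← modByMonic_add_div P c]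
    rw [eval_add, eval_mul, hy0, zero_mul, add_zero]
  have hd : c.derivative.eval y = ∏ j ∈ c.roots.toFinset.erase y, (y - j) := by
    rw [hs.eval_root_derivative hc hy, Finset.prod_eq_multiset_prod, Finset.erase_val,
      Multiset.toFinset_val, hn.dedup]
  rw [hP, hd]
  rfl

lemma sum_roots_map_eval_div_derivative {c : R[X]} (hc : c.Monic) (ψ : R →+* N)
    (hs : (c.map ψ).Splits) (hn : (c.map ψ).roots.Nodup) (P : R[X]) :
    ((c.map ψ).roots.map fun y => (P.map ψ).eval y / (c.map ψ).derivative.eval y).sum =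
      ψ ((P %ₘ c).coeff (c.natDegree - 1)) := by
  rw [sum_roots_eval_div_derivative (hc.map ψ) hs hn,
    ← map_modByMonic ψ hc, coeff_map, hc.natDegree_map]

end Trace

/-! ### The curve over a transcendental value of `x` -/

section Curve

variable {K N : Type*} [Field K] [Field N] [Algebra K N] {χ : K[X][X]}

/-- If `x` is transcendental over `K`, a polynomial not divisible by the irreducible `χ` is coprime
to `χ` as a polynomial in `y`. -/
lemma isCoprime_map_aeval (hχ : χ.Monic) (hirr : Irreducible χ) {x : N} (hx : Transcendental K x)
    {G : K[X][X]} (hG : ¬ χ ∣ G) :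
    IsCoprime (χ.map (aeval x : K[X] →ₐ[K] N).toRingHom)
      (G.map (aeval x : K[X] →ₐ[K] N).toRingHom) := by
  have hinj : Function.Injective (aeval x : K[X] →ₐ[K] N).toRingHom :=
    transcendental_iff_injective.mp hx
  have hirr' := hχ.irreducible_iff_irreducible_map_fraction_map (K := FractionRing K[X]) |>.mp hirr
  have hdvd : ¬ χ.map (algebraMap K[X] (FractionRing K[X])) ∣
      G.map (algebraMap K[X] (FractionRing K[X])) := by
    rwa [map_dvd_map _ (IsFractionRing.injective K[X] (FractionRing K[X])) hχ]
  have hco := (hirr'.coprime_iff_not_dvd.mpr hdvd).map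
    (mapRingHom (IsFractionRing.lift (K := FractionRing K[X]) hinj))
  simp only [coe_mapRingHom, Polynomial.map_map] at hco
  have hcomp : (IsFractionRing.lift (K := FractionRing K[X]) hinj).comp
      (algebraMap K[X] (FractionRing K[X])) = (aeval x : K[X] →ₐ[K] N).toRingHom :=
    RingHom.ext fun z => IsFractionRing.lift_algebraMap hinj z
  rwa [hcomp] at hco

lemma aevalAeval_ne_zero_of_not_dvd (hχ : χ.Monic) (hirr : Irreducible χ) {x y : N}
    (hx : Transcendental K x) {G : K[X][X]} (hG : ¬ χ ∣ G) (hy : aevalAeval x y χ = 0) :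
    aevalAeval x y G ≠ 0 := by
  obtain ⟨u, v, h⟩ := isCoprime_map_aeval hχ hirr hx hG
  intro h0
  rw [aevalAeval_eq_eval_map] at hy h0
  have := congrArg (eval y) h
  rw [eval_add, eval_mul, eval_mul, hy, h0, mul_zero, mul_zero, add_zero, eval_one] at this
  exact zero_ne_one this

variable [CharZero K]

lemma not_dvd_derivative (hχ : χ.Monic) (hirr : Irreducible χ) : ¬ χ ∣ derivative χ := by
  have h1 : χ.natDegree ≠ 0 := fun h => hirr.not_isUnit (by
    rw [hχ.natDegree_eq_zero.mp h]; exact isUnit_one)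
  intro h
  have hd : derivative χ ≠ 0 := fun h0 => h1 (derivative_eq_zero.mp h0)
  exact (natDegree_derivative_lt h1).not_ge (natDegree_le_of_dvd h hd)

lemma nodup_roots_map_aeval (hχ : χ.Monic) (hirr : Irreducible χ) {x : N}
    (hx : Transcendental K x) : (χ.map (aeval x : K[X] →ₐ[K] N).toRingHom).roots.Nodup := by
  refine nodup_roots ?_
  rw [Separable, derivative_map]
  exact isCoprime_map_aeval hχ hirr hx (not_dvd_derivative hχ hirr)

end Curve

/-! ### The trace of a rational function on the curve -/

section CurveTrace

variable {K : Type*} (M : Type*) {N : Type*} [Field K] [Field M] [Field N] [Algebra K M]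

/-- A polynomial over `K`, regarded as a polynomial over `M`. -/
abbrev overField (P : K[X][X]) : M[X][X] := P.map (mapRingHom (algebraMap K M))

variable {M} [Algebra K N] [Algebra M N] [IsScalarTower K M N] {χ p q f₁ : K[X][X]} {f₂ : K[X]}

lemma map_overField (x : N) (P : K[X][X]) :
    (overField M P).map (aeval x : M[X] →ₐ[M] N).toRingHom =
      P.map (aeval x : K[X] →ₐ[K] N).toRingHom := by
  rw [overField, Polynomial.map_map]
  congr 1
  ext <;> simp [← IsScalarTower.algebraMap_apply]

lemma mem_roots_map_aeval (hχ : χ.Monic) {x y : N} :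
    y ∈ (χ.map (aeval x : K[X] →ₐ[K] N).toRingHom).roots ↔ aevalAeval x y χ = 0 := by
  rw [mem_roots (hχ.map _).ne_zero, IsRoot, aevalAeval_eq_eval_map]

variable [CharZero K]

lemma evalQuotient_eq_div (hχ : χ.Monic) (hirr : Irreducible χ) (hq : ¬ χ ∣ q)
    (hf : IsRepresentation χ p q f₁ f₂) {x y : N} (hx : Transcendental K x)
    (hy : aevalAeval x y χ = 0) :
    evalQuotient K p q x y =
      aevalAeval x y f₁ / (aeval x f₂ * aevalAeval x y (derivative χ)) := by
  have h1 := aevalAeval_ne_zero_of_not_dvd hχ hirr hx hq hy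
  have h2 := aevalAeval_ne_zero_of_not_dvd hχ hirr hx (not_dvd_derivative hχ hirr) hy
  have h3 : aeval x f₂ ≠ 0 := fun h => hx ⟨f₂, hf.ne_zero, h⟩
  obtain ⟨g, hg⟩ := hf.dvd
  have h4 := congrArg (aevalAeval x y) hg
  rw [map_mul, hy, zero_mul, map_sub, map_mul, map_mul, map_mul, aevalAeval_C, sub_eq_zero] at h4
  rw [evalQuotient, div_eq_div_iff h1 (mul_ne_zero h3 h2), h4]
  ring

/-- The sum of `f G` over the points of the curve with given `x` is a rational function of `x`. -/
lemma sum_evalQuotient_mul (hχ : χ.Monic) (hirr : Irreducible χ) (hq : ¬ χ ∣ q)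
    (hf : IsRepresentation χ p q f₁ f₂) {x : N} (hx : Transcendental K x)
    (hs : (χ.map (aeval x : K[X] →ₐ[K] N).toRingHom).Splits) (G : M[X][X]) :
    ((χ.map (aeval x : K[X] →ₐ[K] N).toRingHom).roots.map fun y =>
      evalQuotient K p q x y * aevalAeval x y G).sum =
      aeval x (((overField M f₁ * G) %ₘ overField M χ).coeff (χ.natDegree - 1)) / aeval x f₂ := by
  have h := sum_roots_map_eval_div_derivative (hχ.map (mapRingHom (algebraMap K M)))
    (aeval x : M[X] →ₐ[M] N).toRingHom (by rwa [map_overField])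
    (by rw [map_overField]; exact nodup_roots_map_aeval hχ hirr hx) (overField M f₁ * G)
  rw [hχ.natDegree_map, map_overField] at h
  refine Eq.trans ?_ (congrArg (· / aeval x f₂) h)
  rw [div_eq_mul_inv, ← Multiset.sum_map_mul_right]
  refine congrArg _ (Multiset.map_congr rfl fun y hy => ?_)
  rw [mem_roots_map_aeval hχ] at hy
  rw [evalQuotient_eq_div hχ hirr hq hf hx hy, ← aevalAeval_eq_eval_map, map_mul,
    aevalAeval_map_map, derivative_map, ← aevalAeval_eq_eval_map]
  simp only [div_eq_mul_inv, mul_inv]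
  ring

end CurveTrace

lemma separable_map_of_fractionRing {R M : Type*} [CommRing R] [IsDomain R] [Field M]
    {g : R →+* M} (hg : Function.Injective g) {P : R[X]}
    (hP : (P.map (algebraMap R (FractionRing R))).Separable) : (P.map g).Separable := by
  have h := Separable.map (f := IsFractionRing.lift (K := FractionRing R) hg) hP
  rw [Polynomial.map_map] at h
  have hcomp : (IsFractionRing.lift (K := FractionRing R) hg).comp (algebraMap _ _) = g :=
    RingHom.ext fun z => IsFractionRing.lift_algebraMap hg z
  rwa [hcomp] at h

/-! ### The resultant -/

section Resultant

variable {K M N : Type*} [Field K] [Field M] [Algebra K M] {m : ℕ} (a : Fin m → M)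
  (χ : K[X][X]) (θ : (MvPolynomial (Fin m) K)[X][X])

/-- The resultant `r(x,a)` with the given elements of `M` substituted for the indeterminates. -/
def resultantOver : M[X] :=
  (resultantInX χ θ).map (MvPolynomial.aeval a : MvPolynomial (Fin m) K →ₐ[K] M).toRingHom

variable {χ}

lemma natDegree_ne_zero (hχ : χ.Monic) (hirr : Irreducible χ) : χ.natDegree ≠ 0 := fun h =>
  hirr.not_isUnit (by rw [hχ.natDegree_eq_zero.mp h]; exact isUnit_one)

/-- The resultant is a combination of `θ` and `χ`. -/
lemma exists_mul_add_mul_eq_resultantOver (hχ : χ.Monic) (hirr : Irreducible χ) :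
    ∃ A B : M[X][X], A * specialize K a θ + B * overField M χ = C (resultantOver a χ θ) := by
  have hn : (χ.map (mapRingHom (MvPolynomial.C : K →+* MvPolynomial (Fin m) K))).natDegree ≠ 0 := by
    rw [hχ.natDegree_map]
    exact natDegree_ne_zero hχ hirr
  obtain ⟨B, A, -, -, h⟩ := exists_mul_add_mul_eq_C_resultant
    (χ.map (mapRingHom (MvPolynomial.C : K →+* MvPolynomial (Fin m) K))) θ le_rfl le_rfl (Or.inl hn)
  let φ := mapRingHom (mapRingHom
    (MvPolynomial.aeval a : MvPolynomial (Fin m) K →ₐ[K] M).toRingHom)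
  refine ⟨φ A, φ B, ?_⟩
  have h2 := congrArg φ h
  have hχM : φ (χ.map (mapRingHom (MvPolynomial.C : K →+* MvPolynomial (Fin m) K))) =
      overField M χ := by
    simp only [φ, coe_mapRingHom, Polynomial.map_map, overField]
    congr 1
    ext <;> simp
  rw [map_add, map_mul, map_mul, hχM] at h2
  rw [mul_comm (φ A), mul_comm (φ B), add_comm]
  refine h2.trans ?_
  simp only [φ, coe_mapRingHom, map_C]
  rfl

variable {a θ} {F₀ : K[X]} {F : (MvPolynomial (Fin m) K)[X]}

/-- `F` with the given elements of `M` substituted for the indeterminates. -/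
abbrev factorOver (a : Fin m → M) (F : (MvPolynomial (Fin m) K)[X]) : M[X] :=
  F.map (MvPolynomial.aeval a : MvPolynomial (Fin m) K →ₐ[K] M).toRingHom

lemma resultantOver_eq_mul (hF : IsResultantFactorization χ θ F₀ F) :
    resultantOver a χ θ = F₀.map (algebraMap K M) * factorOver a F := by
  rw [resultantOver, hF.eq_mul, Polynomial.map_mul, Polynomial.map_map]
  congr 2
  ext
  simp [← MvPolynomial.algebraMap_eq]

lemma factorOver_ne_zero (hF : HasNoAlgebraicRoot F) (ha : AlgebraicIndependent K a) :
    factorOver a F ≠ 0 := by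
  intro h
  have : F = 0 := (Polynomial.map_eq_zero_iff ha).mp h
  exact hF 0 (by rw [this, eval₂_zero])

lemma resultantOver_ne_zero (hF : IsResultantFactorization χ θ F₀ F)
    (ha : AlgebraicIndependent K a) : resultantOver a χ θ ≠ 0 := by
  rw [resultantOver_eq_mul hF]
  exact mul_ne_zero ((Polynomial.map_ne_zero_iff (algebraMap K M).injective).mpr hF.ne_zero)
    (factorOver_ne_zero hF.no_algebraic_root ha)

lemma separable_factorOver (hF : IsSquarefreeInX F) (ha : AlgebraicIndependent K a) :
    (factorOver a F).Separable :=
  separable_map_of_fractionRing ha hF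

lemma transcendental_of_eval_factorOver [IsAlgClosed M] (hF : HasNoAlgebraicRoot F)
    (ha : AlgebraicIndependent K a) {x : M} (hx : (factorOver a F).eval x = 0) :
    Transcendental K x := by
  intro halg
  let k := AlgebraicClosure K
  let _ : Algebra k M := (IsAlgClosed.lift : k →ₐ[K] M).toRingHom.toAlgebra
  have : IsScalarTower K k M :=
    IsScalarTower.of_algebraMap_eq fun c => ((IsAlgClosed.lift : k →ₐ[K] M).commutes c).symm
  obtain ⟨z, rfl⟩ := exists_algebraMap_eq_of_isAlgebraic (k := k) halg
  have ha' : AlgebraicIndependent k a := ha.extendScalars k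
  refine hF z (ha' ?_)
  change MvPolynomial.aeval a _ = MvPolynomial.aeval a 0
  rw [map_zero, ← hx, ← AlgHom.coe_toRingHom, hom_eval₂, eval_map]
  congr 1
  · ext <;> simp
    · exact (IsScalarTower.algebraMap_apply K k M _).symm
  · simp

end Resultant

/-! ### Expansions of the roots of `χ` and of `θ` -/

section Expansions

variable {K M : Type*} [Field K] [Field M] [Algebra K M] {m : ℕ}

lemma transcendental_xAt (β : M) : Transcendental M (xAt β) := by
  rintro ⟨P, hP, h⟩
  exact aeval_xAt_ne_zero β hP h

lemma transcendental_xAtInfinity : Transcendental M (xAtInfinity : HahnSeries ℚ M) := by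
  rintro ⟨P, hP, h⟩
  exact aeval_xAtInfinity_ne_zero hP h

lemma isAlgebraic_of_mem_rootsIn {g : K[X]} {β : M} (hβ : β ∈ rootsIn K M g) :
    IsAlgebraic K β := by
  classical
  rw [rootsIn, Multiset.mem_toFinset, mem_aroots] at hβ
  exact ⟨g, hβ⟩

lemma mem_expansionPoints {g : K[X]} {x : HahnSeries ℚ M} (hx : x ∈ expansionPoints K M g) :
    Transcendental M x ∧ x ∈ puiseuxSubring K M := by
  rcases hx with ⟨β, hβ, rfl⟩ | rfl
  · exact ⟨transcendental_xAt β, add_mem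
      (single_mem_puiseuxSubring 0 (isAlgebraic_of_mem_rootsIn hβ))
      (single_mem_puiseuxSubring 1 isAlgebraic_one)⟩
  · exact ⟨transcendental_xAtInfinity, single_mem_puiseuxSubring (-1) isAlgebraic_one⟩

lemma exists_map_eq_map_aeval {x : HahnSeries ℚ M} (hx : x ∈ puiseuxSubring K M) :
    ∃ ψ : K[X] →+* puiseuxSubring K M,
      (puiseuxSubring K M).subtype.comp ψ = (aeval x : K[X] →ₐ[K] HahnSeries ℚ M).toRingHom := by
  let ι : K →+* puiseuxSubring K M := (algebraMap K (HahnSeries ℚ M)).codRestrict _ fun c => by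
    rw [algebraMap_hahnSeries]
    exact single_mem_puiseuxSubring 0 (isAlgebraic_algebraMap c)
  refine ⟨eval₂RingHom ι ⟨x, hx⟩, ?_⟩
  ext <;> simp [ι]

/-- Puiseux's theorem for the roots `y` of `χ(x, y)`. -/
lemma splits_map_aeval [CharZero M] [IsAlgClosed M] {χ : K[X][X]} (hχ : χ.Monic)
    {x : HahnSeries ℚ M} (hx : x ∈ puiseuxSubring K M) :
    (χ.map (aeval x : K[X] →ₐ[K] HahnSeries ℚ M).toRingHom).Splits ∧
      ∀ y ∈ localRoots K χ x, y ∈ puiseuxSubring K M := by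
  obtain ⟨ψ, hψ⟩ := exists_map_eq_map_aeval hx
  have hP := splits_of_monic_puiseuxSubring (hχ.map ψ)
  have hmap : χ.map (aeval x : K[X] →ₐ[K] HahnSeries ℚ M).toRingHom =
      (χ.map ψ).map (puiseuxSubring K M).subtype := by rw [Polynomial.map_map, hψ]
  refine ⟨hmap ▸ hP.map _, fun y hy => ?_⟩
  rw [localRoots, hmap, mem_roots ((hχ.map ψ).map _).ne_zero, IsRoot,
    hP.eq_prod_roots_of_monic (hχ.map ψ), Polynomial.map_multiset_prod, eval_multiset_prod,
    Multiset.prod_eq_zero_iff, Multiset.map_map, Multiset.map_map, Multiset.mem_map] at hy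
  obtain ⟨z, -, hz⟩ := hy
  simp only [Function.comp_apply, Polynomial.map_sub, map_X, map_C, eval_sub, eval_X, eval_C,
    sub_eq_zero] at hz
  rw [hz]
  exact z.2

lemma aevalAeval_eq_sum {x y : HahnSeries ℚ M} (P : M[X][X]) :
    aevalAeval x y P = ∑ j ∈ P.support, ∑ i ∈ (P.coeff j).support,
      HahnSeries.C ((P.coeff j).coeff i) * (x ^ i * y ^ j) := by
  rw [aevalAeval_eq_eval_map, eval_map, eval₂_eq_sum, Polynomial.sum]
  refine Finset.sum_congr rfl fun j _ => ?_
  rw [AlgHom.toRingHom_eq_coe, RingHom.coe_coe, aeval_def, eval₂_eq_sum, Polynomial.sum,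
    Finset.sum_mul]
  refine Finset.sum_congr rfl fun i _ => ?_
  rw [algebraMap_hahnSeries, Algebra.algebraMap_self, RingHom.id_apply, mul_assoc]

section AffineForms

variable {a : Fin m → M}

lemma zero_mem_affineForms : (0 : M) ∈ affineForms K a :=
  ⟨0, 0, isAlgebraic_zero, fun _ => isAlgebraic_zero, by simp⟩

lemma add_mem_affineForms {u v : M} (hu : u ∈ affineForms K a) (hv : v ∈ affineForms K a) :
    u + v ∈ affineForms K a := by
  obtain ⟨c₀, c, h₀, h, rfl⟩ := hu
  obtain ⟨d₀, d, g₀, g, rfl⟩ := hv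
  refine ⟨c₀ + d₀, c + d, h₀.add g₀, fun i => (h i).add (g i), ?_⟩
  simp only [Pi.add_apply, add_mul, Finset.sum_add_distrib]
  ring

lemma sum_mem_affineForms {ι : Type*} {s : Finset ι} {u : ι → M}
    (hu : ∀ i ∈ s, u i ∈ affineForms K a) : ∑ i ∈ s, u i ∈ affineForms K a :=
  Finset.sum_induction _ (· ∈ affineForms K a) (fun _ _ => add_mem_affineForms)
    zero_mem_affineForms hu

lemma mul_mem_affineForms {u v : M} (hu : u ∈ affineForms K a) (hv : IsAlgebraic K v) :
    u * v ∈ affineForms K a := by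
  obtain ⟨c₀, c, h₀, h, rfl⟩ := hu
  refine ⟨c₀ * v, fun i => c i * v, h₀.mul hv, fun i => (h i).mul hv, ?_⟩
  rw [add_mul, Finset.sum_mul]
  exact congrArg _ (Finset.sum_congr rfl fun i _ => by ring)

lemma aeval_mem_affineForms {P : MvPolynomial (Fin m) K} (hP : P.totalDegree ≤ 1) :
    MvPolynomial.aeval a P ∈ affineForms K a := by
  rw [MvPolynomial.aeval_def, MvPolynomial.eval₂_eq]
  refine sum_mem_affineForms fun d hd => ?_
  rw [mul_comm]
  refine mul_mem_affineForms ?_ (isAlgebraic_algebraMap _)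
  have hdeg : d.degree ≤ 1 := (MvPolynomial.le_totalDegree hd).trans hP
  rcases Nat.le_one_iff_eq_zero_or_eq_one.mp hdeg with h | h
  · rw [Finsupp.degree_eq_zero_iff] at h
    exact ⟨1, 0, isAlgebraic_one, fun _ => isAlgebraic_zero, by simp [h]⟩
  · obtain ⟨i, rfl⟩ := (Finsupp.sum_eq_one_iff d).mp h
    classical
    refine ⟨0, Pi.single i 1, isAlgebraic_zero, fun j => ?_, ?_⟩
    · rcases eq_or_ne j i with rfl | hj
      · rw [Pi.single_eq_same]; exact isAlgebraic_one
      · rw [Pi.single_eq_of_ne hj]; exact isAlgebraic_zero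
    · simp [Pi.single_apply, Finsupp.single_apply]

lemma affineForms_subset_rationalFunctionField :
    affineForms K a ⊆ rationalFunctionField K a := by
  rintro _ ⟨c₀, c, h₀, h, rfl⟩
  have halg : ∀ {z : M}, IsAlgebraic K z → z ∈ rationalFunctionField K a := fun hz =>
    IntermediateField.subset_adjoin _ _ (Or.inl hz)
  refine add_mem (halg h₀) (sum_mem fun i _ => mul_mem (halg (h i)) ?_)
  exact IntermediateField.subset_adjoin _ _ (Or.inr ⟨i, rfl⟩)

end AffineForms

/-- The coefficients of the expansion of `θ` are affine forms in the indeterminates. -/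
lemma coeff_localTheta_mem_affineForms (a : Fin m → M) {θ : (MvPolynomial (Fin m) K)[X][X]}
    (hθ : ∀ i j : ℕ, ((θ.coeff j).coeff i).totalDegree ≤ 1) {x y : HahnSeries ℚ M}
    (hx : x ∈ puiseuxSubring K M) (hy : y ∈ puiseuxSubring K M) (e : ℚ) :
    (localTheta K a θ x y).coeff e ∈ affineForms K a := by
  rw [localTheta, aevalAeval_eq_sum, HahnSeries.coeff_sum]
  refine sum_mem_affineForms fun j _ => ?_
  rw [HahnSeries.coeff_sum]
  refine sum_mem_affineForms fun i _ => ?_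
  rw [HahnSeries.C_mul_eq_smul, HahnSeries.coeff_smul, smul_eq_mul]
  refine mul_mem_affineForms ?_ ((mul_mem (pow_mem hx i) (pow_mem hy j) :
    x ^ i * y ^ j ∈ puiseuxSubring K M).2 e)
  rw [specialize, coeff_map, coe_mapRingHom, coeff_map]
  exact aeval_mem_affineForms (hθ i j)

lemma coeff_mul_mem {E : IntermediateField K M} {s t : HahnSeries ℚ M} (hs : ∀ e, s.coeff e ∈ E)
    (ht : ∀ e, t.coeff e ∈ E) (e : ℚ) : (s * t).coeff e ∈ E := by
  rw [HahnSeries.coeff_mul]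
  exact sum_mem fun i _ => mul_mem (hs _) (ht _)

lemma coeff_one_mem (E : IntermediateField K M) (e : ℚ) :
    (1 : HahnSeries ℚ M).coeff e ∈ E := by
  rw [HahnSeries.coeff_one]
  split_ifs
  exacts [one_mem E, zero_mem E]

lemma coeff_pow_mem {E : IntermediateField K M} {s : HahnSeries ℚ M} (hs : ∀ e, s.coeff e ∈ E)
    (n : ℕ) (e : ℚ) : (s ^ n).coeff e ∈ E := by
  induction n generalizing e with
  | zero => rw [pow_zero]; exact coeff_one_mem E e
  | succ n ih => rw [pow_succ]; exact coeff_mul_mem ih hs e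

lemma coeff_single_mem {E : IntermediateField K M} (i : ℚ) {c : M} (hc : c ∈ E) (e : ℚ) :
    (HahnSeries.single i c).coeff e ∈ E := by
  rw [HahnSeries.coeff_single]
  split_ifs
  exacts [hc, zero_mem E]

lemma coeff_heval_mem {E : IntermediateField K M} {W : HahnSeries ℚ M} (hW : 0 < W.orderTop)
    (hE : ∀ e, W.coeff e ∈ E) {f : PowerSeries M} (hf : ∀ n, f.coeff n ∈ E) (e : ℚ) :
    (PowerSeries.heval W f).coeff e ∈ E := by
  rw [PowerSeries.coeff_heval]
  refine finsum_induction (· ∈ E) (zero_mem E) (fun _ _ => add_mem) fun n => ?_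
  simp only [HahnSeries.SummableFamily.coeff_apply,
    HahnSeries.SummableFamily.powerSeriesFamily_of_orderTop_pos hW, HahnSeries.coeff_smul]
  exact mul_mem (hf n) (coeff_pow_mem hE n e)

lemma coeff_zero_localLog (L : M → M) (s : HahnSeries ℚ M) :
    (localLog L s).coeff 0 = L s.leadingCoeff := by
  rw [localLog, HahnSeries.coeff_add, PowerSeries.coeff_heval_zero, HahnSeries.C_apply,
    HahnSeries.coeff_single_same]
  simp [← PowerSeries.coeff_zero_eq_constantCoeff_apply]

lemma coeff_localLog_mem {E : IntermediateField K M} (L : M → M) {s : HahnSeries ℚ M}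
    (hs₀ : s ≠ 0) (hs : ∀ e, s.coeff e ∈ E) {e : ℚ} (he : e ≠ 0) : (localLog L s).coeff e ∈ E := by
  rw [localLog, HahnSeries.coeff_add, HahnSeries.C_apply, HahnSeries.coeff_single_of_ne he, zero_add]
  have hlead : s.leadingCoeff ∈ E := by
    rw [HahnSeries.leadingCoeff_eq]
    exact hs _
  refine coeff_heval_mem (orderTop_div_single_sub_one_pos hs₀) (fun i => ?_) (fun n => ?_) e
  · rw [HahnSeries.coeff_sub, div_eq_mul_inv, HahnSeries.inv_single]
    exact sub_mem (coeff_mul_mem hs (coeff_single_mem _ (inv_mem hlead)) i) (coeff_one_mem E i)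
  · rw [PowerSeries.coeff_mk]
    exact div_mem (pow_mem (neg_mem (one_mem E)) _) (natCast_mem E n)

end Expansions

/-! ### The derivative of the local sums -/

section LocalSums

variable {K M : Type*} [Field K] [Field M] [Algebra K M] {m : ℕ}

/-- The scalar actions are those of the algebra structures; the action of `K` on Hahn series found by
instance search is the coefficientwise one. -/
instance isScalarTower_hahnSeries :
    @IsScalarTower K M (HahnSeries ℚ M) Algebra.toSMul Algebra.toSMul Algebra.toSMul :=
  IsScalarTower.of_algebraMap_eq (R := K) (S := M) (A := HahnSeries ℚ M) fun c => by
    rw [algebraMap_hahnSeries, algebraMap_hahnSeries, Algebra.algebraMap_self, RingHom.id_apply]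

lemma coeffDerivation_eq_zero_of_mem_puiseuxSubring [CharZero K] (D : Derivation K M M) {s : HahnSeries ℚ M}
    (hs : s ∈ puiseuxSubring K M) : coeffDerivation D s = 0 :=
  coeffDerivation_eq_zero fun e => derivation_eq_zero_of_isAlgebraic D (hs.2 e)

/-- The derivation `D`, applied to the coefficients of a polynomial in `x` and `y`. -/
def derivCoeffs (D : Derivation K M M) : M[X][X] →+ M[X][X] :=
  coeffwise (coeffwise (D : M →+ M))

lemma derivation_mul (D : Derivation K M M) (b c : M) :
    (D : M →+ M) (b * c) = b * (D : M →+ M) c + c * (D : M →+ M) b :=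
  D.leibniz b c

lemma derivCoeffs_mul (D : Derivation K M M) (P Q : M[X][X]) :
    derivCoeffs D (P * Q) = P * derivCoeffs D Q + Q * derivCoeffs D P :=
  coeffwise_mul (coeffwise_mul (derivation_mul D)) P Q

lemma derivCoeffs_overField (D : Derivation K M M) (P : K[X][X]) :
    derivCoeffs D (overField M P) = 0 := by
  refine coeffwise_eq_zero fun j => coeffwise_eq_zero fun i => ?_
  rw [overField, coeff_map, coe_mapRingHom, coeff_map]
  exact D.map_algebraMap _

/-- A derivation of the coefficients commutes with the substitution of series with algebraic
coefficients. -/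
lemma coeffDerivation_aevalAeval (D : Derivation K M M) {x y : HahnSeries ℚ M}
    (hx : coeffDerivation D x = 0) (hy : coeffDerivation D y = 0) (P : M[X][X]) :
    coeffDerivation D (aevalAeval x y P) = aevalAeval x y (derivCoeffs D P) := by
  have h1 : ∀ c : M, coeffDerivation D (algebraMap M (HahnSeries ℚ M) c) =
      algebraMap M (HahnSeries ℚ M) ((D : M →+ M) c) := fun c => by
    rw [algebraMap_hahnSeries, algebraMap_hahnSeries]
    exact coeffDerivation_C D c
  have h2 : ∀ c : M[X], coeffDerivation D ((aeval x : M[X] →ₐ[M] HahnSeries ℚ M).toRingHom c) =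
      (aeval x : M[X] →ₐ[M] HahnSeries ℚ M).toRingHom (coeffwise (D : M →+ M) c) := fun c => by
    have := apply_eval₂_eq (algebraMap M (HahnSeries ℚ M)) h1 (coeffDerivation_mul D) x c
    rwa [hx, mul_zero, add_zero] at this
  rw [aevalAeval_eq_eval_map, aevalAeval_eq_eval_map, eval_map, eval_map]
  have := apply_eval₂_eq _ h2 (coeffDerivation_mul D) y P
  rwa [hy, mul_zero, add_zero] at this

lemma coeffDerivation_evalQuotient (D : Derivation K M M) (p q : K[X][X]) {x y : HahnSeries ℚ M}
    (hx : coeffDerivation D x = 0) (hy : coeffDerivation D y = 0) :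
    coeffDerivation D (evalQuotient K p q x y) = 0 := by
  have h : ∀ P : K[X][X], coeffDerivation D (aevalAeval x y P) = 0 := fun P => by
    rw [← aevalAeval_map_map (R := M), coeffDerivation_aevalAeval D hx hy, derivCoeffs_overField,
      map_zero]
  rw [evalQuotient]
  rcases eq_or_ne (aevalAeval x y q) 0 with h0 | h0
  · rw [h0, div_zero, map_zero]
  · have := h p
    rw [← mul_div_cancel₀ (aevalAeval x y p) h0, coeffDerivation_mul, h q, mul_zero,
      add_zero] at this
    exact (mul_eq_zero.mp this).resolve_left h0

variable {χ p q f₁ : K[X][X]} {f₂ : K[X]} {θ : (MvPolynomial (Fin m) K)[X][X]} {a : Fin m → M}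

/-- The polynomial `N(x)` for which the derivative of `∑ f(x,y) log θ(y)` is
`N(x) / (f₂(x) r(x,a))`. -/
def traceNumerator (D : Derivation K M M) (a : Fin m → M) (χ : K[X][X])
    (θ : (MvPolynomial (Fin m) K)[X][X]) (f₁ : K[X][X]) (A : M[X][X]) : M[X] :=
  ((overField M f₁ * (A * derivCoeffs D (specialize K a θ))) %ₘ overField M χ).coeff
    (χ.natDegree - 1)

lemma aevalAeval_mul_localTheta {N : Type*} [Field N] [Algebra K N] [Algebra M N]
    [IsScalarTower K M N] {A B : M[X][X]}
    (hAB : A * specialize K a θ + B * overField M χ = C (resultantOver a χ θ)) {x y : N}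
    (hy : aevalAeval x y χ = 0) :
    aevalAeval x y A * aevalAeval x y (specialize K a θ) = aeval x (resultantOver a χ θ) := by
  have := congrArg (aevalAeval x y) hAB
  rwa [map_add, map_mul, map_mul, aevalAeval_map_map, hy, mul_zero, add_zero, aevalAeval_C] at this

lemma localTheta_ne_zero (hχ : χ.Monic) (hirr : Irreducible χ)
    (hr : resultantOver a χ θ ≠ 0) {x y : HahnSeries ℚ M} (hx : Transcendental M x)
    (hy : aevalAeval x y χ = 0) : localTheta K a θ x y ≠ 0 := by
  obtain ⟨A, B, hAB⟩ := exists_mul_add_mul_eq_resultantOver a θ hχ hirr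
  intro h0
  have h := aevalAeval_mul_localTheta hAB hy
  rw [localTheta] at h0
  rw [h0, mul_zero] at h
  exact hx ⟨_, hr, h.symm⟩

/-- The derivative of `∑ f(x,y) log θ(y)` is a rational function of `x`. -/
lemma coeffDerivation_Shat [CharZero K] [CharZero M] [IsAlgClosed M] (D : Derivation K M M) (L : M → M)
    (hχ : χ.Monic) (hirr : Irreducible χ) (hq : ¬ χ ∣ q) (hf : IsRepresentation χ p q f₁ f₂)
    (hr : resultantOver a χ θ ≠ 0) {A B : M[X][X]}
    (hAB : A * specialize K a θ + B * overField M χ = C (resultantOver a χ θ))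
    {x : HahnSeries ℚ M} (hx : Transcendental M x) (hxP : x ∈ puiseuxSubring K M)
    (hL : ∀ y ∈ localRoots K χ x, D (L (localTheta K a θ x y).leadingCoeff) =
      D (localTheta K a θ x y).leadingCoeff / (localTheta K a θ x y).leadingCoeff) :
    coeffDerivation D (Shat K a L χ θ p q x) =
      aeval x (traceNumerator D a χ θ f₁ A) /
        aeval x (f₂.map (algebraMap K M) * resultantOver a χ θ) := by
  obtain ⟨hs, hroots⟩ := splits_map_aeval hχ hxP
  have hxK : Transcendental K x := hx.restrictScalars (algebraMap K M).injective
  have hDx := coeffDerivation_eq_zero_of_mem_puiseuxSubring D hxP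
  have hterm : ∀ y ∈ localRoots K χ x,
      coeffDerivation D (evalQuotient K p q x y * localLog L (localTheta K a θ x y)) =
        (evalQuotient K p q x y * aevalAeval x y (A * derivCoeffs D (specialize K a θ))) *
          (aeval x (resultantOver a χ θ))⁻¹ := by
    intro y hy
    have hDy := coeffDerivation_eq_zero_of_mem_puiseuxSubring D (hroots y hy)
    have hχy : aevalAeval x y χ = 0 := (mem_roots_map_aeval hχ).mp hy
    have hθ0 := localTheta_ne_zero hχ hirr hr hx hχy
    rw [coeffDerivation_mul, coeffDerivation_evalQuotient D p q hDx hDy, mul_zero, add_zero,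
      coeffDerivation_localLog D L hθ0 (hL y hy), ← aevalAeval_mul_localTheta hAB hχy, map_mul]
    rw [localTheta] at hθ0 ⊢
    rw [coeffDerivation_aevalAeval D hDx hDy]
    have hA : aevalAeval x y A ≠ 0 := fun h => by
      have h1 := aevalAeval_mul_localTheta hAB hχy
      rw [h, zero_mul] at h1
      exact hx ⟨_, hr, h1.symm⟩
    field_simp
  rw [Shat, map_multiset_sum, Multiset.map_map]
  refine (congrArg Multiset.sum (Multiset.map_congr rfl hterm)).trans ?_
  rw [Multiset.sum_map_mul_right]
  have := sum_evalQuotient_mul hχ hirr hq hf hxK hs (A * derivCoeffs D (specialize K a θ))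
  rw [localRoots, this, map_mul, aeval_map_algebraMap, traceNumerator, ← div_eq_mul_inv, div_div]

/-- At a root of the resultant, `A` times the derivative of `θ` vanishes unless `θ` does, and then
it is the derivative of the resultant by implicit differentiation. -/
lemma aevalAeval_mul_derivCoeffs (D : Derivation K M M) {A B : M[X][X]}
    (hAB : A * specialize K a θ + B * overField M χ = C (resultantOver a χ θ)) {x y : M}
    (hr : (resultantOver a χ θ).eval x = 0) (hy : aevalAeval x y χ = 0) :
    (aevalAeval x y (specialize K a θ) ≠ 0 → aevalAeval x y A = 0) ∧
    (aevalAeval x y (specialize K a θ) = 0 →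
      aevalAeval x y (A * derivCoeffs D (specialize K a θ)) =
        -((resultantOver a χ θ).derivative.eval x * D x)) := by
  have hr' : aeval x (resultantOver a χ θ) = 0 := by rwa [coe_aeval_eq_eval]
  refine ⟨fun h => ?_, fun h => ?_⟩
  · have h1 := aevalAeval_mul_localTheta hAB hy
    rw [hr'] at h1
    exact (mul_eq_zero.mp h1).resolve_right h
  · have h1 := congrArg (fun P => aevalAeval x y (derivCoeffs D P)) hAB
    simp only [map_add, derivCoeffs_mul, derivCoeffs_overField, map_mul, h, zero_mul, mul_zero,
      zero_add, add_zero, aevalAeval_map_map, hy] at h1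
    have h2 : derivCoeffs D (C (resultantOver a χ θ)) =
        C (coeffwise (D : M →+ M) (resultantOver a χ θ)) := coeffwise_C _ _
    have h3 := apply_eval₂_eq (d := (D : M →+ M)) (δ := (D : M →+ M)) (RingHom.id M)
      (fun _ => rfl) (derivation_mul D) x (resultantOver a χ θ)
    have h4 : (coeffwise (D : M →+ M) (resultantOver a χ θ)).eval x =
        -((resultantOver a χ θ).derivative.eval x * D x) := by
      rw [eq_neg_iff_add_eq_zero]
      refine h3.symm.trans ?_
      rw [show eval₂ (RingHom.id M) x (resultantOver a χ θ) = 0 from hr, map_zero]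
    rw [map_mul, h1, h2, aevalAeval_C, coe_aeval_eq_eval, h4]

lemma isAntiderivative_iff_of_isAntiderivative {D : Fin m → Derivation K M M} {u : M}
    {ω : Fin m → M} (hu : IsAntiderivative D u ω) (v : M) :
    IsAntiderivative D v ω ↔ ∃ C : M, IsConstant D C ∧ v = u + C := by
  constructor
  · intro hv
    exact ⟨v - u, fun i => by rw [map_sub, hv i, hu i, sub_self], by ring⟩
  · rintro ⟨C, hC, rfl⟩ i
    rw [map_add, hu i, hC i, add_zero]

end LocalSums

/-! ### The points of intersection and the residues over them -/

section Intersection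

variable {K M : Type*} [Field K] [Field M] [Algebra K M] {m : ℕ}
  {χ p q f₁ : K[X][X]} {f₂ F₀ : K[X]} {θ : (MvPolynomial (Fin m) K)[X][X]}
  {F : (MvPolynomial (Fin m) K)[X]} {a : Fin m → M}

open Classical in
/-- The `y`-coordinates of the common zeros of `χ` and `θ` with given `x`. -/
def intersectionFiber (a : Fin m → M) (χ : K[X][X]) (θ : (MvPolynomial (Fin m) K)[X][X])
    (x : M) : Finset M :=
  (χ.map (aeval x : K[X] →ₐ[K] M).toRingHom).roots.toFinset.filter fun y =>
    aevalAeval x y (specialize K a θ) = 0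

lemma mem_intersectionFiber (hχ : χ.Monic) {x y : M} :
    y ∈ intersectionFiber a χ θ x ↔
      aevalAeval x y χ = 0 ∧ aevalAeval x y (specialize K a θ) = 0 := by
  classical
  rw [intersectionFiber, Finset.mem_filter, Multiset.mem_toFinset, mem_roots_map_aeval hχ]

lemma mem_solutions_iff [IsAlgClosed M] (hχ : χ.Monic) (hirr : Irreducible χ)
    (hF : IsResultantFactorization χ θ F₀ F) (ha : AlgebraicIndependent K a) (s : M × M) :
    s ∈ solutions K a χ θ ↔
      s.1 ∈ rootsIn M M (factorOver a F) ∧ s.2 ∈ intersectionFiber a χ θ s.1 := by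
  classical
  have hroot : s.1 ∈ rootsIn M M (factorOver a F) ↔ (factorOver a F).eval s.1 = 0 := by
    rw [rootsIn, Multiset.mem_toFinset, mem_aroots, coe_aeval_eq_eval]
    exact and_iff_right (factorOver_ne_zero hF.no_algebraic_root ha)
  rw [mem_intersectionFiber hχ, hroot]
  constructor
  · rintro ⟨h1, h2, h3⟩
    refine ⟨?_, h1, h2⟩
    obtain ⟨A, B, hAB⟩ := exists_mul_add_mul_eq_resultantOver a θ hχ hirr
    have h4 := aevalAeval_mul_localTheta hAB h1
    rw [h2, mul_zero, resultantOver_eq_mul hF, map_mul, aeval_map_algebraMap,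
      coe_aeval_eq_eval] at h4
    exact (mul_eq_zero.mp h4.symm).resolve_left fun h => h3 ⟨F₀, hF.ne_zero, h⟩
  · rintro ⟨h1, h2, h3⟩
    exact ⟨h2, h3, transcendental_of_eval_factorOver hF.no_algebraic_root ha h1⟩

lemma finite_solutions [IsAlgClosed M] (hχ : χ.Monic) (hirr : Irreducible χ)
    (hF : IsResultantFactorization χ θ F₀ F) (ha : AlgebraicIndependent K a) :
    (solutions K a χ θ).Finite := by
  classical
  refine ((rootsIn M M (factorOver a F)).finite_toSet.biUnion (t := fun x =>
    (fun y => (x, y)) '' (intersectionFiber a χ θ x : Set M))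
      fun x _ => (Finset.finite_toSet _).image _).subset fun s hs => ?_
  obtain ⟨h1, h2⟩ := (mem_solutions_iff hχ hirr hF ha s).mp hs
  exact Set.mem_biUnion h1 ⟨s.2, h2, rfl⟩

lemma finsum_solutions [IsAlgClosed M] (hχ : χ.Monic) (hirr : Irreducible χ)
    (hF : IsResultantFactorization χ θ F₀ F) (ha : AlgebraicIndependent K a) (g : M → M → M) :
    ∑ᶠ s ∈ solutions K a χ θ, g s.1 s.2 =
      ∑ x ∈ rootsIn M M (factorOver a F), ∑ y ∈ intersectionFiber a χ θ x, g x y := by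
  rw [finsum_mem_eq_finite_toFinset_sum _ (finite_solutions hχ hirr hF ha)]
  refine Finset.sum_finset_product' _ _ _ fun s => ?_
  rw [Set.Finite.mem_toFinset, mem_solutions_iff hχ hirr hF ha]

/-- The residue at a root of the resultant that is transcendental over `K` is, up to sign, the
contribution to `dv` of the solutions over it. -/
lemma res_traceNumerator_div [CharZero K] [IsAlgClosed M] (D : Derivation K M M) (hχ : χ.Monic) (hirr : Irreducible χ)
    (hq : ¬ χ ∣ q) (hf : IsRepresentation χ p q f₁ f₂) (hF : IsResultantFactorization χ θ F₀ F)
    (hsq : IsSquarefreeInX F) (ha : AlgebraicIndependent K a) {A B : M[X][X]}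
    (hAB : A * specialize K a θ + B * overField M χ = C (resultantOver a χ θ)) {x : M}
    (hx : (factorOver a F).eval x = 0) :
    res (aeval (xAt x) (traceNumerator D a χ θ f₁ A) /
      aeval (xAt x) (f₂.map (algebraMap K M) * resultantOver a χ θ)) =
      -∑ y ∈ intersectionFiber a χ θ x, evalQuotient K p q x y * D x := by
  classical
  have hxK := transcendental_of_eval_factorOver hF.no_algebraic_root ha hx
  have hr0 : (resultantOver a χ θ).eval x = 0 := by
    rw [resultantOver_eq_mul hF, eval_mul, hx, mul_zero]
  have hr' : (resultantOver a χ θ).derivative.eval x ≠ 0 := by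
    rw [resultantOver_eq_mul hF, derivative_mul, eval_add, eval_mul, hx, mul_zero, zero_add,
      eval_mul]
    refine mul_ne_zero (fun h => hxK ⟨F₀, hF.ne_zero, by rwa [eval_map_algebraMap] at h⟩) ?_
    have := (separable_factorOver hsq ha).aeval_derivative_ne_zero (x := x)
      (by rwa [coe_aeval_eq_eval])
    rwa [coe_aeval_eq_eval] at this
  have hf2 : (f₂.map (algebraMap K M)).eval x ≠ 0 := fun h =>
    hxK ⟨f₂, hf.ne_zero, by rwa [eval_map_algebraMap] at h⟩
  obtain ⟨R, hR⟩ := dvd_iff_isRoot.mpr hr0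
  have hRx : R.eval x = (resultantOver a χ θ).derivative.eval x := by
    rw [hR, derivative_mul]
    simp
  have hQ : f₂.map (algebraMap K M) * resultantOver a χ θ =
      (X - C x) * (f₂.map (algebraMap K M) * R) := by
    rw [hR]
    ring
  rw [hQ, res_div_X_sub_C_mul x _ (by rw [eval_mul, hRx]; exact mul_ne_zero hf2 hr'), eval_mul,
    hRx, ← div_div]
  have hsum := sum_evalQuotient_mul hχ hirr hq hf hxK (IsAlgClosed.splits _)
    (A * derivCoeffs D (specialize K a θ))
  rw [← eval_map_algebraMap f₂, coe_aeval_eq_eval] at hsum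
  rw [traceNumerator, ← hsum, div_eq_iff hr', neg_mul, Finset.sum_mul, ← Finset.sum_neg_distrib,
    intersectionFiber, Finset.sum_filter, Finset.sum_eq_multiset_sum, Multiset.toFinset_val,
    (nodup_roots_map_aeval hχ hirr hxK).dedup]
  refine congrArg _ (Multiset.map_congr rfl fun y hy => ?_)
  obtain ⟨h1, h2⟩ := aevalAeval_mul_derivCoeffs D hAB hr0 ((mem_roots_map_aeval hχ).mp hy)
  split_ifs with h
  · rw [h2 h]
    ring
  · rw [map_mul, h1 h, zero_mul, mul_zero]

/-- Abel's formula: the derivative of the sum of residues is `dv`. -/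
lemma isAntiderivative_abelSum [CharZero K] [IsAlgClosed M] [CharZero M] {D : Fin m → Derivation K M M} {L : M → M}
    (hχ : χ.Monic) (hirr : Irreducible χ)
    (hq : ¬ χ ∣ q) (hf : IsRepresentation χ p q f₁ f₂) (hF : IsResultantFactorization χ θ F₀ F)
    (hsq : IsSquarefreeInX F) (ha : AlgebraicIndependent K a)
    (hL : IsLogOn D L (logArguments K a χ θ (f₂ * F₀))) :
    IsAntiderivative D (abelSum K a L χ θ p q (f₂ * F₀)) (dv K a D χ θ p q) := by
  classical
  intro k
  obtain ⟨A, B, hAB⟩ := exists_mul_add_mul_eq_resultantOver a θ hχ hirr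
  have hr := resultantOver_ne_zero hF ha
  have hShat : ∀ x ∈ expansionPoints K M (f₂ * F₀), coeffDerivation (D k) (Shat K a L χ θ p q x) =
      aeval x (traceNumerator (D k) a χ θ f₁ A) /
        aeval x (f₂.map (algebraMap K M) * resultantOver a χ θ) := by
    intro x hx
    obtain ⟨h1, h2⟩ := mem_expansionPoints hx
    exact coeffDerivation_Shat (D k) L hχ hirr hq hf hr hAB h1 h2 fun y hy =>
      hL _ ⟨x, hx, y, hy, rfl⟩ k
  have hg : f₂ * F₀ ≠ 0 := mul_ne_zero hf.ne_zero hF.ne_zero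
  have hQ : f₂.map (algebraMap K M) * resultantOver a χ θ ≠ 0 :=
    mul_ne_zero ((Polynomial.map_ne_zero_iff (algebraMap K M).injective).mpr hf.ne_zero) hr
  have hFr : ∀ x, x ∈ rootsIn M M (factorOver a F) ↔ (factorOver a F).eval x = 0 := fun x => by
    rw [rootsIn, Multiset.mem_toFinset, mem_aroots, coe_aeval_eq_eval]
    exact and_iff_right (factorOver_ne_zero hF.no_algebraic_root ha)
  have hdisj : Disjoint (rootsIn K M (f₂ * F₀)) (rootsIn M M (factorOver a F)) :=
    Finset.disjoint_left.mpr fun x hx hx' =>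
      transcendental_of_eval_factorOver hF.no_algebraic_root ha ((hFr x).mp hx')
        (isAlgebraic_of_mem_rootsIn hx)
  -- The finite poles are the roots of `f₂F₀`, which are algebraic over `K`, and the roots of `F`,
  -- which are transcendental.
  have hres := sum_res_div_eq_coeffInvX_div (traceNumerator (D k) a χ θ f₁ A) hQ
    (rootsIn K M (f₂ * F₀) ∪ rootsIn M M (factorOver a F)) fun γ hγ => by
      rw [resultantOver_eq_mul hF, ← mul_assoc, ← Polynomial.map_mul, eval_mul, mul_eq_zero] at hγ
      rw [Finset.mem_union, hFr]
      refine hγ.imp_left fun h => ?_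
      rw [rootsIn, Multiset.mem_toFinset, mem_aroots]
      exact ⟨hg, by rwa [eval_map_algebraMap] at h⟩
  rw [Finset.sum_union hdisj, Finset.sum_congr rfl fun x hx =>
    res_traceNumerator_div (D k) hχ hirr hq hf hF hsq ha hAB ((hFr x).mp hx),
    Finset.sum_neg_distrib] at hres
  have hfin : coeffDerivation (D k) (Shat K a L χ θ p q xAtInfinity) = _ :=
    hShat _ (Or.inr rfl)
  have hDres : ∀ s : HahnSeries ℚ M, D k (res s) = res (coeffDerivation (D k) s) := fun _ => rfl
  have hDinf : ∀ s : HahnSeries ℚ M, D k (coeffInvX s) = coeffInvX (coeffDerivation (D k) s) :=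
    fun _ => rfl
  rw [dv, finsum_solutions hχ hirr hF ha (fun x y => evalQuotient K p q x y * D k x), abelSum,
    map_sub, map_sum, hDinf, hfin, ← hres, Finset.sum_congr rfl fun β hβ => by
      rw [hDres, hShat _ (Or.inl ⟨β, hβ, rfl⟩)]]
  ring

end Intersection

end

end AbelFormula

theorem theorem4p3 (K : Subfield ℂ) (m : ℕ)
    -- `χ(x,y)`, monic in `y` and irreducible over `ℂ`
    (χ : K[X][X]) (hχ_monic : χ.Monic)
    (hχ_irr : Irreducible (χ.map (mapRingHom K.subtype)))
    -- `θ(x,y,a)`, whose coefficients in `x, y` have degree at most one in `a`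
    (θ : (MvPolynomial (Fin m) K)[X][X])
    (hθ : ∀ i j : ℕ, ((θ.coeff j).coeff i).totalDegree ≤ 1)
    -- `r(x,a) = F₀(x) F(x,a)` with `F` squarefree
    (F₀ : K[X]) (F : (MvPolynomial (Fin m) K)[X])
    (hF : AbelFormula.IsResultantFactorization χ θ F₀ F)
    (hF_sq : AbelFormula.IsSquarefreeInX F)
    -- the rational function `f = p / q = f₁ / (f₂ χ')` on the curve `χ = 0`
    (p q : K[X][X]) (hq : ¬ χ ∣ q) (f₁ : K[X][X]) (f₂ : K[X])
    (hf : AbelFormula.IsRepresentation χ p q f₁ f₂) :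
    -- there is a differential extension of `K(a)` with all the logarithms that may be needed
    (∃ (M : Type) (_ : Field M) (_ : Algebra K M) (_ : IsAlgClosed M) (a : Fin m → M)
      (D : Fin m → Derivation K M M) (L : M → M),
      AbelFormula.IsDifferentialExtension K a D ∧
      AbelFormula.IsLogOn D L {c | c ∈ AbelFormula.affineForms K a ∧ c ≠ 0}) ∧
    ∀ (M : Type*) [Field M] [Algebra K M] [IsAlgClosed M] (a : Fin m → M)
      (D : Fin m → Derivation K M M) (L : M → M),
      AbelFormula.IsDifferentialExtension K a D →
      AbelFormula.IsLogOn D L (AbelFormula.logArguments K a χ θ (f₂ * F₀)) →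
      -- all expressions are well defined, and only logs of affine forms in `a` occur
      ((AbelFormula.solutions K a χ θ).Finite ∧
        (∀ s ∈ AbelFormula.solutions K a χ θ, aevalAeval s.1 s.2 q ≠ 0) ∧
        ∀ x ∈ AbelFormula.expansionPoints K M (f₂ * F₀),
          (AbelFormula.localRoots K χ x).card = χ.natDegree ∧
          ∀ y ∈ AbelFormula.localRoots K χ x,
            AbelFormula.IsPuiseux K y ∧ aevalAeval x y q ≠ 0 ∧
            (AbelFormula.localTheta K a θ x y).leadingCoeff ∈ AbelFormula.affineForms K a ∧
            (AbelFormula.localTheta K a θ x y).leadingCoeff ≠ 0 ∧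
            (AbelFormula.localLog L (AbelFormula.localTheta K a θ x y)).coeff 0 =
              L (AbelFormula.localTheta K a θ x y).leadingCoeff ∧
            ∀ e : ℚ, e ≠ 0 →
              (AbelFormula.localLog L (AbelFormula.localTheta K a θ x y)).coeff e ∈
                AbelFormula.rationalFunctionField K a) ∧
      -- `dv = δ(∑ res - Π)`
      AbelFormula.IsAntiderivative D (AbelFormula.abelSum K a L χ θ p q (f₂ * F₀))
        (AbelFormula.dv K a D χ θ p q) ∧
      -- the antiderivatives of `dv` are exactly the `∑ res - Π + C`
      (∀ v : M, AbelFormula.IsAntiderivative D v (AbelFormula.dv K a D χ θ p q) ↔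
        ∃ C : M, AbelFormula.IsConstant D C ∧
          v = AbelFormula.abelSum K a L χ θ p q (f₂ * F₀) + C) ∧
      -- `∑ ∫ f(x_i,y_i) dx_i = ∑ res - Π + C`, where `I (x_i,y_i) = ∫ f(x_i,y_i) dx_i`
      ∀ I : M × M → M,
        (∀ s ∈ AbelFormula.solutions K a χ θ,
          AbelFormula.IsAntiderivative D (I s)
            (fun k => AbelFormula.evalQuotient K p q s.1 s.2 * D k s.1)) →
        ∃ C : M, AbelFormula.IsConstant D C ∧
          ∑ᶠ s ∈ AbelFormula.solutions K a χ θ, I s =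
            AbelFormula.abelSum K a L χ θ p q (f₂ * F₀) + C := by
  have hirr : Irreducible χ := hχ_monic.irreducible_of_irreducible_map _ _ hχ_irr
  refine ⟨AbelFormula.exists_differentialExtension K m, ?_⟩
  intro M _ _ _ a D L hD hL
  have : CharZero M := charZero_of_injective_algebraMap (algebraMap K M).injective
  have ha := hD.algebraicIndependent
  have hr := AbelFormula.resultantOver_ne_zero hF ha
  have hfin := AbelFormula.finite_solutions hχ_monic hirr hF ha
  have hsum := AbelFormula.isAntiderivative_abelSum hχ_monic hirr hq hf hF hF_sq ha hL
  refine ⟨⟨hfin, fun s hs => ?_, fun x hx => ?_⟩, hsum,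
    AbelFormula.isAntiderivative_iff_of_isAntiderivative hsum, fun I hI => ?_⟩
  · exact AbelFormula.aevalAeval_ne_zero_of_not_dvd hχ_monic hirr hs.2.2 hq hs.1
  · obtain ⟨hxM, hxP⟩ := AbelFormula.mem_expansionPoints hx
    have hxK : Transcendental K x := hxM.restrictScalars (algebraMap K M).injective
    obtain ⟨hs, hroots⟩ := AbelFormula.splits_map_aeval hχ_monic hxP
    refine ⟨?_, fun y hy => ?_⟩
    · rw [AbelFormula.localRoots, ← hs.natDegree_eq_card_roots, hχ_monic.natDegree_map]
    · have hχy := (AbelFormula.mem_roots_map_aeval hχ_monic).mp hy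
      have hne := AbelFormula.localTheta_ne_zero hχ_monic hirr hr hxM hχy
      have hcoeff := AbelFormula.coeff_localTheta_mem_affineForms a hθ hxP (hroots y hy)
      refine ⟨hroots y hy, AbelFormula.aevalAeval_ne_zero_of_not_dvd hχ_monic hirr hxK hq hχy, ?_,
        HahnSeries.leadingCoeff_ne_zero.mpr hne, AbelFormula.coeff_zero_localLog L _,
        fun e he => AbelFormula.coeff_localLog_mem L hne (fun i =>
          AbelFormula.affineForms_subset_rationalFunctionField (hcoeff i)) he⟩
      rw [HahnSeries.leadingCoeff_eq]
      exact hcoeff _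
  · refine (AbelFormula.isAntiderivative_iff_of_isAntiderivative hsum _).mp fun k => ?_
    rw [AbelFormula.dv, finsum_mem_eq_finite_toFinset_sum _ hfin,
      finsum_mem_eq_finite_toFinset_sum _ hfin, map_sum]
    exact Finset.sum_congr rfl fun s hs => hI s (hfin.mem_toFinset.mp hs) k
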